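/- Let $\mathbb D$ be the open unit disc and $\mathbb T$ the unit circle with normalized arclength measure, and write $L^2=L^2(\mathbb T)$, $\chi(\zeta)=\zeta$. Let $H^2\subset L^2$ be the Hardy space, i.e. the space of all $f\in L^2$ whose Fourier coefficients of negative index vanish. An inner function is a bounded analytic function $u$ on $\mathbb D$ whose radial limits (also denoted $u$) satisfy $|u|=1$ almost everywhere on $\mathbb T$. For an inner function $u$ let $K_u=H^2\ominus uH^2$ be the model space and $P_{K_u}:L^2\to K_u$ the orthogonal projection, and let $C_u$ be the conjugation $C_uf=u\,\overline{\chi f}$, which maps $K_u$ onto itself. A bounded linear operator $A$ on $K_u$ is called a truncated Toeplitz operator if there is $\varphi\in L^2$ such that $Af=P_{K_u}(\varphi f)$ for every bounded function $f\in K_u$; it is called $C_u$-symmetric if $A^*=C_uAC_u$. Put $Q_A(f)=\langle Af,f\rangle$ for $f\in K_u$, and $b_a(z)=(z-a)/(1-\bar a z)$ for $a\in\mathbb D$. **Theorem.** Let $u$ be an inner function with $u(a)=0$ for some $a\in\mathbb D$. (Note that $u/b_a$ is then inner and $K_{u/b_a}\subset K_u$.) A bounded linear operator $A$ on $K_u$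 is a truncated Toeplitz operator if and only if $A$ is $C_u$-symmetric and $$Q_A(C_{u/b_a}f)=Q_A(f)\qquad\text{for every } f\in K_{u/b_a}.$$ -/

import Mathlib

open MeasureTheory Filter Topology Complex ComplexConjugate
open scoped ENNReal InnerProductSpace

noncomputable section

namespace TTO

/-- The unit circle, parametrized as `ℝ / ℤ` through `t ↦ exp (2 π i t)`. -/
abbrev T : Type := AddCircle (1 : ℝ)

/-- Normalized arclength measure on the circle. -/
abbrev σ : Measure T := AddCircle.haarAddCircle

/-- `L² = L²(𝕋)`. -/
abbrev L2 : Type := Lp ℂ 2 σ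

/-- The coordinate function `χ(ζ) = ζ` on the circle. -/
def χ (t : T) : ℂ := (AddCircle.toCircle t : ℂ)

/-- The open unit disc. -/
abbrev disc : Set ℂ := Metric.ball 0 1

/-- `u` has radial limit `w` at the boundary point `χ t`. -/
def HasRadialLimit (u : ℂ → ℂ) (t : T) (w : ℂ) : Prop :=
  Tendsto (fun r : ℝ => u (r * χ t)) (𝓝[<] 1) (𝓝 w)

/-- The boundary function of `u`: its radial limit wherever this exists. -/
def bdry (u : ℂ → ℂ) (t : T) : ℂ := limUnder (𝓝[<] (1 : ℝ)) fun r : ℝ => u (r * χ t)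

/-- Inner functions: bounded analytic functions in the disc (only the values of `u` there matter)
whose radial limits are unimodular almost everywhere on the circle. -/
structure IsInner (u : ℂ → ℂ) : Prop where
  differentiableOn : DifferentiableOn ℂ u disc
  bounded : ∃ M : ℝ, ∀ z ∈ disc, ‖u z‖ ≤ M
  unimodular : ∀ᵐ t ∂σ, ∃ w : ℂ, HasRadialLimit u t w ∧ ‖w‖ = 1

lemma HasRadialLimit.bdry_eq {u : ℂ → ℂ} {t : T} {w : ℂ} (h : HasRadialLimit u t w) :
    bdry u t = w := h.limUnder_eq

lemma norm_χ (t : T) : ‖χ t‖ = 1 := Circle.norm_coe _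

lemma continuous_χ : Continuous χ :=
  continuous_subtype_val.comp (AddCircle.continuous_toCircle)

lemma mul_χ_mem_disc {r : ℝ} (h0 : 0 ≤ r) (h1 : r < 1) (t : T) : (r : ℂ) * χ t ∈ disc := by
  simp [norm_χ, abs_of_nonneg h0, h1]

lemma eventually_radius : ∀ᶠ r : ℝ in 𝓝[<] 1, 0 ≤ r ∧ r < 1 := by
  filter_upwards [self_mem_nhdsWithin, mem_nhdsWithin_of_mem_nhds (Ioi_mem_nhds zero_lt_one)]
    with r h1 h0
  exact ⟨le_of_lt h0, h1⟩

lemma continuous_dilate {u : ℂ → ℂ} (hu : DifferentiableOn ℂ u disc) {r : ℝ} (h0 : 0 ≤ r)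
    (h1 : r < 1) : Continuous fun t : T => u (r * χ t) :=
  hu.continuousOn.comp_continuous (continuous_const.mul continuous_χ) (mul_χ_mem_disc h0 h1)

lemma IsInner.hasRadialLimit_bdry {u : ℂ → ℂ} (hu : IsInner u) :
    ∀ᵐ t ∂σ, HasRadialLimit u t (bdry u t) := by
  filter_upwards [hu.unimodular] with t ⟨w, hw, _⟩
  rwa [hw.bdry_eq]

lemma IsInner.norm_bdry {u : ℂ → ℂ} (hu : IsInner u) : ∀ᵐ t ∂σ, ‖bdry u t‖ = 1 := by
  filter_upwards [hu.unimodular] with t ⟨w, hw, h⟩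
  rwa [hw.bdry_eq]

lemma IsInner.aestronglyMeasurable_bdry {u : ℂ → ℂ} (hu : IsInner u) :
    AEStronglyMeasurable (bdry u) σ := by
  let r : ℕ → ℝ := fun n => 1 - 1 / ((n : ℝ) + 1)
  have hr1 : ∀ n, r n < 1 := fun n => sub_lt_self _ (by positivity)
  have hr0 : ∀ n, 0 ≤ r n := fun n => by
    have : 1 / ((n : ℝ) + 1) ≤ 1 := by
      rw [div_le_one (by positivity)]; linarith [(Nat.cast_nonneg n : (0 : ℝ) ≤ n)]
    simp only [r]; linarith
  have hr : Tendsto r atTop (𝓝[<] 1) := by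
    refine tendsto_nhdsWithin_iff.2 ⟨?_, Eventually.of_forall hr1⟩
    simpa [r] using
      (tendsto_const_nhds (x := (1 : ℝ))).sub (tendsto_one_div_add_atTop_nhds_zero_nat (𝕜 := ℝ))
  refine aestronglyMeasurable_of_tendsto_ae atTop
    (f := fun n t => u (r n * χ t))
    (fun n => (continuous_dilate hu.differentiableOn (hr0 n) (hr1 n)).aestronglyMeasurable) ?_
  filter_upwards [hu.hasRadialLimit_bdry] with t ht
  exact Tendsto.comp (g := fun r : ℝ => u (r * χ t)) ht hr

lemma IsInner.memLp_bdry {u : ℂ → ℂ} (hu : IsInner u) : MemLp (bdry u) ∞ σ :=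
  memLp_top_of_bound hu.aestronglyMeasurable_bdry 1 (hu.norm_bdry.mono fun _ h => h.le)

/-- The Hardy space `H²` as a subspace of `L²`. -/
def H2 : Submodule ℂ L2 where
  carrier := {f | ∀ n : ℤ, n < 0 → fourierCoeff (f : T → ℂ) n = 0}
  add_mem' {f g} hf hg n hn := by
    rw [← fourierBasis_repr, map_add, lp.coeFn_add, Pi.add_apply, fourierBasis_repr,
      fourierBasis_repr, hf n hn, hg n hn, add_zero]
  zero_mem' n _ := by
    rw [← fourierBasis_repr, map_zero]; rfl
  smul_mem' c f hf n hn := by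
    rw [← fourierBasis_repr, map_smul, lp.coeFn_smul, Pi.smul_apply, fourierBasis_repr, hf n hn,
      smul_zero]

lemma mem_H2 {f : L2} : f ∈ H2 ↔ ∀ n : ℤ, n < 0 → fourierCoeff (f : T → ℂ) n = 0 := Iff.rfl

lemma isClosed_H2 : IsClosed (H2 : Set L2) := by
  have : (H2 : Set L2) = ⋂ n : ℤ, ⋂ _ : n < 0, {f : L2 | ⟪fourierLp 2 n, f⟫_ℂ = 0} := by
    ext f
    simp only [SetLike.mem_coe, mem_H2, Set.mem_iInter, Set.mem_ofPred_eq]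
    refine forall₂_congr fun n _ => ?_
    rw [← fourierBasis_repr, HilbertBasis.repr_apply_apply, coe_fourierBasis]
  rw [this]
  refine isClosed_iInter fun n => isClosed_iInter fun _ => ?_
  exact isClosed_eq (continuous_const.inner continuous_id) continuous_const

/-- The subspace `u H²` of `L²`. -/
def mulH2 (u : ℂ → ℂ) : Submodule ℂ L2 where
  carrier := {g | ∃ h ∈ H2, (g : T → ℂ) =ᵐ[σ] fun t => bdry u t * h t}
  add_mem' := by
    rintro f g ⟨h, hh, hf⟩ ⟨k, hk, hg⟩
    refine ⟨h + k, H2.add_mem hh hk, ?_⟩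
    filter_upwards [hf, hg, Lp.coeFn_add f g, Lp.coeFn_add h k] with t h1 h2 h3 h4
    rw [h3, h4, Pi.add_apply, Pi.add_apply, h1, h2, mul_add]
  zero_mem' := by
    refine ⟨0, H2.zero_mem, ?_⟩
    filter_upwards [Lp.coeFn_zero ℂ 2 σ] with t h1
    rw [h1]; simp
  smul_mem' := by
    rintro c f ⟨h, hh, hf⟩
    refine ⟨c • h, H2.smul_mem c hh, ?_⟩
    filter_upwards [hf, Lp.coeFn_smul c f, Lp.coeFn_smul c h] with t h1 h3 h4
    rw [h3, h4, Pi.smul_apply, Pi.smul_apply, h1, smul_eq_mul, smul_eq_mul, mul_left_comm]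

/-- The model space `K_u = H² ⊖ u H²`. -/
def modelSpace (u : ℂ → ℂ) : Submodule ℂ L2 := H2 ⊓ (mulH2 u)ᗮ

instance (u : ℂ → ℂ) : CompleteSpace (modelSpace u) :=
  (isClosed_H2.inter (Submodule.isClosed_orthogonal _)).completeSpace_coe

lemma memLp_mul (φ : L2) {f : T → ℂ} (hf : MemLp f ∞ σ) : MemLp (fun t => φ t * f t) 2 σ :=
  hf.mul (Lp.memLp φ)

/-- `A` is a truncated Toeplitz operator on `K_u`: for some symbol `φ ∈ L²`, `A f` is the orthogonal
projection of `φ f` for every bounded `f ∈ K_u`. -/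
def IsTruncatedToeplitz (u : ℂ → ℂ) (A : modelSpace u →L[ℂ] modelSpace u) : Prop :=
  ∃ φ : L2, ∀ (f : modelSpace u) (hf : MemLp ((f : L2) : T → ℂ) ∞ σ),
    A f = (modelSpace u).orthogonalProjectionOnto (memLp_mul φ hf).toLp

lemma memLp_conj (u : ℂ → ℂ) (hu : IsInner u) (f : L2) :
    MemLp (fun t => bdry u t * conj (χ t * f t)) 2 σ := by
  have h1 : MemLp (fun t => χ t * f t) 2 σ :=
    (Lp.memLp f).mul (r := 2) (memLp_top_of_bound continuous_χ.aestronglyMeasurable 1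
      (Eventually.of_forall fun t => (norm_χ t).le))
  exact h1.star.mul (r := 2) hu.memLp_bdry

/-- The conjugation `C_u f = u * conj (χ f)` of `L²`. -/
def conjL2 {u : ℂ → ℂ} (hu : IsInner u) (f : L2) : L2 := (memLp_conj u hu f).toLp

lemma coeFn_conjL2 {u : ℂ → ℂ} (hu : IsInner u) (f : L2) :
    conjL2 hu f =ᵐ[σ] fun t => bdry u t * conj (χ t * f t) := MemLp.coeFn_toLp _

lemma fourierCoeff_eq (f : T → ℂ) (n : ℤ) :
    fourierCoeff f n = ∫ t, fourier (-n) t * f t ∂σ := rfl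

lemma fourierLp_mem_H2 (m : ℕ) : fourierLp 2 (m : ℤ) ∈ H2 := by
  intro n hn
  rw [← fourierBasis_repr, HilbertBasis.repr_apply_apply, coe_fourierBasis]
  exact orthonormal_fourier.2 (by omega)

/-- If `f, h ∈ H²` then `χ f h` has mean zero. -/
lemma integral_χ_mul_mul {f h : L2} (hf : f ∈ H2) (hh : h ∈ H2) :
    ∫ t, χ t * f t * h t ∂σ = 0 := by
  have hk : MemLp (fun t => conj (χ t * h t)) 2 σ := by
    have h1 : MemLp (fun t => χ t * h t) 2 σ :=
      (Lp.memLp h).mul (r := 2) (memLp_top_of_bound continuous_χ.aestronglyMeasurable 1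
        (Eventually.of_forall fun t => (norm_χ t).le))
    exact h1.star
  have hke := hk.coeFn_toLp
  have key : ⟪hk.toLp, f⟫_ℂ = ∫ t, χ t * f t * h t ∂σ := by
    rw [L2.inner_def]
    refine integral_congr_ae ?_
    filter_upwards [hke] with t ht
    rw [ht, RCLike.inner_apply, conj_conj]
    ring
  have hco : ∀ n : ℤ, 0 ≤ n → fourierCoeff (hk.toLp : T → ℂ) n = 0 := by
    intro n hn
    have h0 := hh (-n - 1) (by omega)
    rw [fourierCoeff_eq] at h0 ⊢
    rw [← (starRingEnd ℂ).map_zero, ← h0, ← integral_conj]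
    refine integral_congr_ae ?_
    filter_upwards [hke] with t ht
    have : fourier (-(-n - 1)) t = fourier n t * χ t := by
      rw [show -(-n - 1) = n + 1 by ring, fourier_add, fourier_one]; rfl
    rw [ht, this, fourier_neg, map_mul, map_mul, map_mul, mul_assoc]
  rw [← key, ← (fourierBasis.hasSum_inner_mul_inner hk.toLp f).tsum_eq]
  refine (tsum_congr fun n => ?_).trans tsum_zero
  rcases lt_or_ge n 0 with hn | hn
  · rw [← HilbertBasis.repr_apply_apply, fourierBasis_repr, hf n hn, mul_zero]
  · rw [← inner_conj_symm, ← HilbertBasis.repr_apply_apply, fourierBasis_repr, hco n hn, map_zero,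
      zero_mul]

lemma conjL2_mem {u : ℂ → ℂ} (hu : IsInner u) {f : L2} (hf : f ∈ modelSpace u) :
    conjL2 hu f ∈ modelSpace u := by
  obtain ⟨hf1, hf2⟩ := Submodule.mem_inf.1 hf
  refine Submodule.mem_inf.2 ⟨?_, ?_⟩
  · intro n hn
    obtain ⟨m, rfl⟩ : ∃ m : ℕ, n = -(m : ℤ) - 1 := ⟨(-n - 1).toNat, by omega⟩
    have hg : MemLp (fun t => bdry u t * fourierLp 2 (m : ℤ) t) 2 σ :=
      (Lp.memLp (fourierLp 2 (m : ℤ))).mul (r := 2) hu.memLp_bdry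
    have h0 : ⟪f, hg.toLp⟫_ℂ = 0 := (Submodule.mem_orthogonal' _ _).1 hf2 _
      ⟨_, fourierLp_mem_H2 m, hg.coeFn_toLp⟩
    rw [L2.inner_def] at h0
    rw [fourierCoeff_eq, ← h0]
    refine integral_congr_ae ?_
    filter_upwards [coeFn_conjL2 hu f, hg.coeFn_toLp, coeFn_fourierLp (T := 1) 2 (m : ℤ)]
      with t h1 h2 h3
    have : fourier (-(-(m : ℤ) - 1)) t * conj (χ t) = fourier m t := by
      rw [show -(-(m : ℤ) - 1) = m + 1 by ring, fourier_add, fourier_one, mul_assoc]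
      change _ * (χ t * conj (χ t)) = _
      rw [mul_conj, normSq_eq_norm_sq, norm_χ]; simp
    rw [h1, h2, h3, RCLike.inner_apply, map_mul, ← this]
    ring
  · rw [Submodule.mem_orthogonal]
    rintro g ⟨h, hh, hg⟩
    rw [L2.inner_def, ← (starRingEnd ℂ).map_zero, ← integral_χ_mul_mul hf1 hh, ← integral_conj]
    refine integral_congr_ae ?_
    filter_upwards [coeFn_conjL2 hu f, hg, hu.norm_bdry] with t h1 h2 h3
    have : bdry u t * conj (bdry u t) = 1 := by
      rw [mul_conj, normSq_eq_norm_sq, h3]; simp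
    rw [h1, h2, RCLike.inner_apply]
    simp only [map_mul]
    linear_combination (conj (χ t) * conj (f t) * conj (h t)) * this

/-- The conjugation `C_u` of the model space `K_u`. -/
def modelConj {u : ℂ → ℂ} (hu : IsInner u) (f : modelSpace u) : modelSpace u :=
  ⟨conjL2 hu f, conjL2_mem hu f.2⟩

/-- `A` is `C`-symmetric: `A* = C A C`. -/
def IsCSymmetric {H : Type*} [NormedAddCommGroup H] [InnerProductSpace ℂ H] [CompleteSpace H]
    (C : H → H) (A : H →L[ℂ] H) : Prop :=
  ∀ f : H, ContinuousLinearMap.adjoint A f = C (A (C f))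

/-- The quadratic form `Q_A(f) = ⟨A f, f⟩`, for an inner product `⟨·, ·⟩` that is linear in its
first argument (Mathlib's inner product is linear in its second argument). -/
def quadForm {H : Type*} [NormedAddCommGroup H] [InnerProductSpace ℂ H]
    (A : H →L[ℂ] H) (f : H) : ℂ := ⟪f, A f⟫_ℂ

/-- The Blaschke factor `b_a(z) = (z - a) / (1 - conj a * z)`. -/
def blaschke (a z : ℂ) : ℂ := (z - a) / (1 - conj a * z)

/-- The quotient `u / b_a` of a function with `u a = 0`, with its removable singularity at `a`
filled in: `dslope u a z` is `(u z - u a) / (z - a)` for `z ≠ a` and `u'(a)` for `z = a`. -/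
def divBlaschke (u : ℂ → ℂ) (a z : ℂ) : ℂ := (1 - conj a * z) * dslope u a z

lemma one_sub_ne_zero {a z : ℂ} (ha : a ∈ disc) (hz : ‖z‖ ≤ 1) : 1 - conj a * z ≠ 0 := by
  intro h
  have h1 : ‖conj a * z‖ = 1 := by rw [← sub_eq_zero.1 h, norm_one]
  rw [norm_mul, RCLike.norm_conj] at h1
  have ha' : ‖a‖ < 1 := by simpa using ha
  nlinarith [norm_nonneg a, norm_nonneg z]

lemma blaschke_mul_divBlaschke {u : ℂ → ℂ} {a : ℂ} (ha : a ∈ disc) (hua : u a = 0) {z : ℂ}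
    (hz : z ∈ disc) : blaschke a z * divBlaschke u a z = u z := by
  have h1 := one_sub_ne_zero ha (z := z) (by simpa using (le_of_lt (by simpa using hz : ‖z‖ < 1)))
  have h2 := sub_smul_dslope u a z
  rw [hua, sub_zero, smul_eq_mul] at h2
  rw [blaschke, divBlaschke, ← h2]
  rw [← mul_assoc, div_mul_cancel₀ _ h1]

lemma norm_sub_eq {a z : ℂ} (hz : ‖z‖ = 1) : ‖z - a‖ = ‖1 - conj a * z‖ := by
  have : 1 - conj a * z = z * conj (z - a) := by
    have : z * conj z = 1 := by rw [mul_conj, normSq_eq_norm_sq, hz]; simp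
    rw [map_sub, mul_sub, this, mul_comm]
  rw [this, norm_mul, RCLike.norm_conj, hz, one_mul]

lemma χ_ne {a : ℂ} (ha : a ∈ disc) (t : T) : χ t - a ≠ 0 := by
  intro h
  have := norm_χ t
  rw [sub_eq_zero.1 h] at this
  simp [this] at ha

lemma tendsto_dilate (t : T) : Tendsto (fun r : ℝ => (r : ℂ) * χ t) (𝓝[<] 1) (𝓝 (χ t)) := by
  have : Tendsto (fun r : ℝ => (r : ℂ) * χ t) (𝓝 1) (𝓝 (((1 : ℝ) : ℂ) * χ t)) :=
    (continuous_ofReal.mul continuous_const).tendsto 1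
  rw [ofReal_one, one_mul] at this
  exact this.mono_left nhdsWithin_le_nhds

lemma isInner_blaschke {a : ℂ} (ha : a ∈ disc) : IsInner (blaschke a) := by
  have hne : ∀ z ∈ Metric.closedBall (0 : ℂ) 1, 1 - conj a * z ≠ 0 := fun z hz =>
    one_sub_ne_zero ha (by simpa using hz)
  have hd : ContinuousOn (blaschke a) (Metric.closedBall 0 1) :=
    ContinuousOn.div (by fun_prop) (by fun_prop) hne
  refine ⟨?_, ?_, Eventually.of_forall fun t => ⟨blaschke a (χ t), ?_, ?_⟩⟩
  · exact DifferentiableOn.div (by fun_prop) (by fun_prop)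
      fun z hz => hne z (Metric.ball_subset_closedBall hz)
  · obtain ⟨M, hM⟩ := (isCompact_closedBall (0 : ℂ) 1).exists_bound_of_continuousOn hd
    exact ⟨M, fun z hz => hM z (Metric.ball_subset_closedBall hz)⟩
  · have h1 := tendsto_dilate t
    exact Tendsto.div (h1.sub_const a) (tendsto_const_nhds.sub (h1.const_mul _))
      (one_sub_ne_zero ha (norm_χ t).le)
  · rw [blaschke, norm_div, norm_sub_eq (norm_χ t), div_self]
    exact norm_ne_zero_iff.2 (one_sub_ne_zero ha (norm_χ t).le)

lemma isInner_divBlaschke {u : ℂ → ℂ} (hu : IsInner u) {a : ℂ} (ha : a ∈ disc) (hua : u a = 0) :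
    IsInner (divBlaschke u a) := by
  have hd : DifferentiableOn ℂ (divBlaschke u a) disc := by
    refine DifferentiableOn.mul (by fun_prop) ?_
    exact (differentiableOn_dslope (Metric.isOpen_ball.mem_nhds ha)).2 hu.differentiableOn
  refine ⟨hd, ?_, ?_⟩
  · obtain ⟨M, hM⟩ := hu.bounded
    obtain ⟨ε, hε, hsub⟩ := Metric.nhds_basis_closedBall.mem_iff.1
      (Metric.isOpen_ball.mem_nhds ha)
    obtain ⟨N, hN⟩ := (isCompact_closedBall a ε).exists_bound_of_continuousOn
      (hd.continuousOn.mono hsub)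
    refine ⟨max N (2 * (M / ε)), fun z hz => ?_⟩
    by_cases hza : z ∈ Metric.closedBall a ε
    · exact (hN z hza).trans (le_max_left _ _)
    · refine le_trans ?_ (le_max_right _ _)
      have hza' : ε < ‖z - a‖ := by simpa [dist_eq_norm] using hza
      have hne : z ≠ a := by
        rintro rfl
        simp [hε.le] at hza
      have h1 : ‖1 - conj a * z‖ ≤ 2 := by
        have ha' : ‖a‖ < 1 := by simpa using ha
        have hz' : ‖z‖ < 1 := by simpa using hz
        calc ‖1 - conj a * z‖ ≤ ‖(1 : ℂ)‖ + ‖conj a * z‖ := norm_sub_le _ _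
          _ ≤ 2 := by
            rw [norm_one, norm_mul, RCLike.norm_conj]
            nlinarith [norm_nonneg a, norm_nonneg z]
      have h2 : ‖dslope u a z‖ ≤ M / ε := by
        rw [dslope_of_ne _ hne, slope_def_field, hua, sub_zero, norm_div]
        exact div_le_div₀ ((norm_nonneg _).trans (hM z hz)) (hM z hz) hε hza'.le
      rw [divBlaschke, norm_mul]
      exact mul_le_mul h1 h2 (norm_nonneg _) zero_le_two
  · filter_upwards [hu.unimodular] with t ⟨w, hw, hw1⟩
    refine ⟨(1 - conj a * χ t) * (w / (χ t - a)), ?_, ?_⟩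
    · have h1 := tendsto_dilate t
      have h2 : Tendsto (fun r : ℝ => (1 - conj a * (r * χ t)) * (u (r * χ t) / (r * χ t - a)))
          (𝓝[<] 1) (𝓝 ((1 - conj a * χ t) * (w / (χ t - a)))) :=
        (tendsto_const_nhds.sub (h1.const_mul _)).mul
          (Tendsto.div hw (h1.sub_const a) (χ_ne ha t))
      refine h2.congr' ?_
      filter_upwards [h1.eventually_ne (sub_ne_zero.1 (χ_ne ha t))] with r hr
      rw [divBlaschke, dslope_of_ne _ hr, slope_def_field, hua, sub_zero]
    · rw [norm_mul, norm_div, hw1, norm_sub_eq (norm_χ t)]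
      exact mul_one_div_cancel (norm_ne_zero_iff.2 (one_sub_ne_zero ha (norm_χ t).le))

/-- Multiplication by an inner function maps `H²` into itself. -/
lemma mul_mem_H2 {w : ℂ → ℂ} (hw : IsInner w) {h g : L2} (hh : h ∈ H2)
    (hg : g =ᵐ[σ] fun t => bdry w t * h t) : g ∈ H2 := by
  intro n hn
  have hint : Integrable h σ := (Lp.memLp h).integrable one_le_two
  rw [fourierCoeff_congr_ae hg, fourierCoeff_eq]
  obtain ⟨M, hM⟩ := hw.bounded
  have hlim : Tendsto (fun r : ℝ => ∫ t, fourier (-n) t * (w (r * χ t) * h t) ∂σ) (𝓝[<] 1)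
      (𝓝 (∫ t, fourier (-n) t * (bdry w t * h t) ∂σ)) := by
    refine tendsto_integral_filter_of_dominated_convergence (fun t => M * ‖h t‖) ?_ ?_
      (hint.norm.const_mul M) ?_
    · filter_upwards [eventually_radius] with r hr
      exact (map_continuous _).aestronglyMeasurable.mul
        ((continuous_dilate hw.differentiableOn hr.1 hr.2).aestronglyMeasurable.mul
          hint.aestronglyMeasurable)
    · filter_upwards [eventually_radius] with r hr
      refine Eventually.of_forall fun t => ?_
      rw [norm_mul, norm_mul, fourier_apply, Circle.norm_coe, one_mul]
      exact mul_le_mul_of_nonneg_right (hM _ (mul_χ_mem_disc hr.1 hr.2 t)) (norm_nonneg _)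
    · filter_upwards [hw.hasRadialLimit_bdry] with t ht
      exact (Tendsto.mul_const _ ht).const_mul _
  refine tendsto_nhds_unique hlim (tendsto_const_nhds.congr' ?_)
  filter_upwards [eventually_radius] with r ⟨h0, h1⟩
  let c : ℕ → ℂ := fun k => (k.factorial : ℂ)⁻¹ * iteratedDeriv k w 0
  have hsum : ∀ z ∈ disc, HasSum (fun k => c k * z ^ k) (w z) := fun z hz => by
    have := Complex.hasSum_taylorSeries_on_ball hw.differentiableOn hz
    have e : (fun k => c k * z ^ k) =
        fun k : ℕ => (k.factorial : ℂ)⁻¹ • (z - 0) ^ k • iteratedDeriv k w 0 := by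
      funext k
      simp only [c, sub_zero, smul_eq_mul]
      ring
    rw [e]
    exact this
  have hterm : ∀ (k : ℕ) (t : T), fourier (-n) t * (c k * (r * χ t) ^ k * h t) =
      c k * r ^ k * (fourier (-(n - k)) t * h t) := fun k t => by
    have : fourier (-(n - k)) t = fourier (-n) t * χ t ^ k := by
      rw [show -(n - (k : ℤ)) = -n + k by ring, fourier_add]
      congr 1
      rw [fourier_apply, natCast_zsmul, AddCircle.toCircle_nsmul, Circle.coe_pow]; rfl
    rw [this]; ring
  have hnorm : Summable fun k => ‖c k * (r : ℂ) ^ k‖ :=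
    (hsum r (by simp [abs_of_nonneg h0, h1])).summable.norm
  have hI : ∀ k : ℕ, Integrable (fun t => c k * r ^ k * (fourier (-(n - k)) t * h t)) σ :=
    fun k => (hint.fourier_smul _).const_mul _
  have := hasSum_integral_of_summable_integral_norm
    (F := fun (k : ℕ) (t : T) => c k * r ^ k * (fourier (-(n - k)) t * h t)) hI (by
      refine (hnorm.mul_right (∫ t, ‖h t‖ ∂σ)).congr fun k => ?_
      rw [← integral_const_mul]
      refine integral_congr_ae (Eventually.of_forall fun t => ?_)
      simp [fourier_apply, Circle.norm_coe])
  have hz : ∀ k : ℕ, ∫ t, c k * r ^ k * (fourier (-(n - k)) t * h t) ∂σ = 0 := fun k => by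
    rw [integral_const_mul, ← fourierCoeff_eq, hh (n - k) (by omega), mul_zero]
  simp only [hz] at this
  rw [← tsum_zero, this.tsum_eq]
  refine integral_congr_ae (Eventually.of_forall fun t => ?_)
  simp only [← hterm]
  exact ((((hsum _ (mul_χ_mem_disc h0 h1 t)).mul_right (h t)).mul_left _).tsum_eq)

/-- If `v` divides `u` in the sense of inner functions then `K_v ⊆ K_u`. -/
lemma modelSpace_le {u v w : ℂ → ℂ} (hv : IsInner v) (hw : IsInner w)
    (h : ∀ z ∈ disc, w z * v z = u z) : modelSpace v ≤ modelSpace u := by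
  refine inf_le_inf_left _ (Submodule.orthogonal_le ?_)
  rintro g ⟨f, hf, hg⟩
  have hm : MemLp (fun t => bdry w t * f t) 2 σ := (Lp.memLp f).mul (r := 2) hw.memLp_bdry
  refine ⟨hm.toLp, mul_mem_H2 hw hf hm.coeFn_toLp, ?_⟩
  filter_upwards [hg, hm.coeFn_toLp, hv.hasRadialLimit_bdry, hw.hasRadialLimit_bdry]
    with t h1 h2 h3 h4
  have : HasRadialLimit u t (bdry w t * bdry v t) := by
    refine (Tendsto.mul h4 h3).congr' ?_
    filter_upwards [eventually_radius] with r hr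
    exact h _ (mul_χ_mem_disc hr.1 hr.2 t)
  rw [h1, h2, this.bdry_eq]
  ring

lemma modelSpace_divBlaschke_le {u : ℂ → ℂ} (hu : IsInner u) {a : ℂ} (ha : a ∈ disc)
    (hua : u a = 0) : modelSpace (divBlaschke u a) ≤ modelSpace u :=
  modelSpace_le (isInner_divBlaschke hu ha hua) (isInner_blaschke ha)
    fun _ hz => blaschke_mul_divBlaschke ha hua hz

end TTO

end

/-!
Write `k` for the Cauchy kernel `1 / (1 - conj a * z)`, `b = b_a` and `v = u / b`.  All arguments
take place on the circle, and the orthogonality they use is that `χ f h` has mean zero for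
`f, h ∈ H²`, combined with the boundary identity `conj k * b = χ k`.

For a truncated Toeplitz operator with symbol `φ` and bounded `f`, `g`, the form `⟨A f, g⟩` is
`∫ φ f conj g`.  The conjugation `C_u` turns `f conj g` into `g conj f` and `C_v` preserves `|f|`, so
both conditions hold on bounded functions (`IsTruncatedToeplitz.isCSymmetric`,
`IsTruncatedToeplitz.quadForm_modelConj`).  They extend to the whole space because bounded functions
are dense in a model space (`dense_bounded`): the projection of `χ ^ m` onto `K_w` is `χ ^ m - w q`
with a polynomial `q`.

Conversely, `C_v f = C_u (b f)` for `f ∈ K_v`, so `C_u`-symmetry turns the second condition into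
`Q_A (b f) = Q_A f`, and polarization gives `⟨A b f, b g⟩ = ⟨A f, g⟩` on `K_v`
(`inner_blaschkeMul`).  Since `u a = 0`, the kernel `k` lies in `K_u`, and every `f ∈ K_u` is
`c k + b f₁` with `f₁ ∈ K_v`; the map `f ↦ f₁` is `backShift`.  With `p = A k` and `q = A* k`, the
symbol `φ = p / k + conj (q / k) - c`, for a suitable constant `c`, has a form that agrees with that
of `A` as soon as one argument is `k`; this rests on the multiplicativity of evaluation at `a`
(`inner_conjFun_mul_kernelL2`).  Hence the difference of the two forms takes the same value at
`(f, g)` and at `(f₁, g₁)` (`sub_symMul_modelShift`).  Iterating, it remains to see that the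
difference tends to zero along the iterated shifts.  For the form of `A` this holds because the
powers of the backward shift tend to zero strongly (`tendsto_iterate_backShift`); for the unbounded
symbol, because an analytic symbol allows the powers of the shift to be moved off one argument,
which is bounded, at the price of multiplying the other by `b ^ n`
(`tendsto_inner_symMul_of_mem_H2`).
-/

noncomputable section

namespace TTO

/-! ### Multiplication operators on `L²` -/

/-- Multiplication of `L²` functions by a function in `L^∞`, as a bounded bilinear map. -/
def mulLinf : Lp ℂ ∞ σ →L[ℂ] L2 →L[ℂ] L2 :=
  (ContinuousLinearMap.mul ℂ ℂ).holderL σ ∞ 2 2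

lemma coeFn_mulLinf (m : Lp ℂ ∞ σ) (f : L2) : mulLinf m f =ᵐ[σ] fun t => m t * f t :=
  (ContinuousLinearMap.mul ℂ ℂ).coeFn_holder m f

/-- Multiplication of `L²` functions by a continuous function on the circle. -/
def mulC : C(T, ℂ) →L[ℂ] L2 →L[ℂ] L2 :=
  mulLinf.comp (ContinuousMap.toLp ∞ σ ℂ)

lemma coeFn_mulC (m : C(T, ℂ)) (f : L2) : mulC m f =ᵐ[σ] fun t => m t * f t := by
  filter_upwards [coeFn_mulLinf (ContinuousMap.toLp ∞ σ ℂ m) f,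
    ContinuousMap.coeFn_toLp (p := ∞) (𝕜 := ℂ) σ m] with t h1 h2
  rw [← h2, ← h1]; rfl

lemma mulC_mulC (m n : C(T, ℂ)) (f : L2) : mulC m (mulC n f) = mulC (m * n) f := by
  refine Lp.ext ?_
  filter_upwards [coeFn_mulC m (mulC n f), coeFn_mulC n f, coeFn_mulC (m * n) f] with t h1 h2 h3
  rw [h1, h2, h3, ContinuousMap.mul_apply, mul_assoc]

lemma mulC_one (f : L2) : mulC 1 f = f := by
  refine Lp.ext ?_
  filter_upwards [coeFn_mulC 1 f] with t h1
  rw [h1, ContinuousMap.one_apply, one_mul]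

lemma inner_eq_integral (f g : L2) : ⟪f, g⟫_ℂ = ∫ t, conj (f t) * g t ∂σ := by
  rw [L2.inner_def]
  refine integral_congr_ae (Eventually.of_forall fun t => ?_)
  simp only [RCLike.inner_apply]
  ring

lemma inner_mulC_left (m : C(T, ℂ)) (f g : L2) : ⟪mulC m f, g⟫_ℂ = ⟪f, mulC (star m) g⟫_ℂ := by
  rw [inner_eq_integral, inner_eq_integral]
  refine integral_congr_ae ?_
  filter_upwards [coeFn_mulC m f, coeFn_mulC (star m) g] with t h1 h2
  rw [h1, h2, map_mul, ContinuousMap.star_apply, ← starRingEnd_apply]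
  ring

lemma memLp_mulC (m : C(T, ℂ)) {f : L2} (hf : MemLp f ∞ σ) : MemLp (mulC m f) ∞ σ := by
  have hm : MemLp m ∞ σ :=
    (memLp_congr_ae (ContinuousMap.coeFn_toLp (p := ∞) (𝕜 := ℂ) σ m)).1 (Lp.memLp _)
  exact (memLp_congr_ae (coeFn_mulC m f)).2 (hf.mul (r := ∞) hm)

/-- The constant function `1` in `L²`. -/
def oneL2 : L2 := fourierLp 2 0

lemma oneL2_mem_H2 : oneL2 ∈ H2 := by
  have := fourierLp_mem_H2 0
  rwa [Nat.cast_zero] at this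

lemma coeFn_oneL2 : oneL2 =ᵐ[σ] fun _ => 1 := by
  filter_upwards [coeFn_fourierLp (T := 1) 2 0] with t h
  rw [oneL2, h, fourier_zero]

/-- The pointwise complex conjugate of an `L²` function. -/
def conjFun (f : L2) : L2 := (Lp.memLp f).star.toLp

lemma coeFn_conjFun (f : L2) : conjFun f =ᵐ[σ] fun t => conj (f t) := MemLp.coeFn_toLp _

/-- The product of a symbol `φ ∈ L²` with a bounded function `f`, as an element of `L²`. -/
def symMul (φ f : L2) (hf : MemLp f ∞ σ) : L2 := (memLp_mul φ hf).toLp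

lemma coeFn_symMul (φ f : L2) (hf : MemLp f ∞ σ) :
    symMul φ f hf =ᵐ[σ] fun t => φ t * f t := MemLp.coeFn_toLp _

lemma inner_symMul_swap (φ f g : L2) (hf : MemLp f ∞ σ) (hg : MemLp g ∞ σ) :
    ⟪g, symMul φ f hf⟫_ℂ = ⟪symMul (conjFun φ) g hg, f⟫_ℂ := by
  rw [inner_eq_integral, inner_eq_integral]
  refine integral_congr_ae ?_
  filter_upwards [coeFn_symMul φ f hf, coeFn_symMul (conjFun φ) g hg, coeFn_conjFun φ]
    with t h1 h2 h3
  rw [h1, h2, h3, map_mul, conj_conj]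
  ring

lemma eq_zero_of_fourierCoeff {f : L2} (h : ∀ n : ℤ, ⟪fourierLp 2 n, f⟫_ℂ = 0) : f = 0 := by
  apply fourierBasis.repr.injective
  rw [map_zero]
  ext n
  rw [HilbertBasis.repr_apply_apply, coe_fourierBasis, h n]; rfl

lemma inner_fourierLp (n : ℤ) (f : L2) : ⟪fourierLp 2 n, f⟫_ℂ = fourierCoeff f n := by
  rw [← fourierBasis_repr, HilbertBasis.repr_apply_apply, coe_fourierBasis]

lemma mem_H2_iff_inner {f : L2} : f ∈ H2 ↔ ∀ n : ℤ, n < 0 → ⟪fourierLp 2 n, f⟫_ℂ = 0 := by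
  simp only [inner_fourierLp]; rfl

/-- The coordinate function as a continuous function. -/
def χC : C(T, ℂ) := ⟨χ, continuous_χ⟩

lemma χC_apply (t : T) : χC t = χ t := rfl

lemma fourier_eq_χC : fourier 1 = χC := by
  ext t; rw [fourier_one]; rfl

lemma mulC_fourier (m n : ℤ) : mulC (fourier m) (fourierLp 2 n) = fourierLp 2 (m + n) := by
  refine Lp.ext ?_
  filter_upwards [coeFn_mulC (fourier m) (fourierLp 2 n), coeFn_fourierLp (T := 1) 2 n,
    coeFn_fourierLp (T := 1) 2 (m + n)] with t h1 h2 h3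
  rw [h1, h2, h3, fourier_add]

lemma star_fourier (m : ℤ) : star (fourier m : C(T, ℂ)) = fourier (-m) := by
  ext t; rw [fourier_neg, ContinuousMap.star_apply, ← starRingEnd_apply]

lemma mulC_fourier_mem_H2 {f : L2} (hf : f ∈ H2) (m : ℕ) : mulC (fourier m) f ∈ H2 := by
  rw [mem_H2_iff_inner] at hf ⊢
  intro n hn
  have := inner_mulC_left (fourier (-(m : ℤ))) (fourierLp 2 n) f
  rw [star_fourier, neg_neg, mulC_fourier] at this
  rw [← this]
  exact hf _ (by omega)

lemma mulC_χC_mem_H2 {f : L2} (hf : f ∈ H2) : mulC χC f ∈ H2 := by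
  have := mulC_fourier_mem_H2 hf 1
  rwa [Nat.cast_one, fourier_eq_χC] at this

/-- The mean of the product of `χ` and two `H²` functions vanishes, in terms of inner products. -/
lemma inner_conj_χ_mul {f g h x : L2} (hf : f ∈ H2) (hh : h ∈ H2)
    (hx : (fun t => conj (g t) * x t) =ᵐ[σ] fun t => χ t * f t * h t) : ⟪g, x⟫_ℂ = 0 := by
  rw [inner_eq_integral, integral_congr_ae hx, integral_χ_mul_mul hf hh]

/-- `H²` is stable under products with bounded `H²` functions. -/
lemma symMul_mem_H2 {φ f : L2} (hφ : φ ∈ H2) (hf : f ∈ H2) (hfb : MemLp f ∞ σ) :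
    symMul φ f hfb ∈ H2 := by
  rw [mem_H2_iff_inner]
  intro n hn
  obtain ⟨m, rfl⟩ : ∃ m : ℕ, n = -(m : ℤ) - 1 := ⟨(-n - 1).toNat, by omega⟩
  refine inner_conj_χ_mul (mulC_fourier_mem_H2 hφ m) hf ?_
  filter_upwards [coeFn_symMul φ f hfb, coeFn_fourierLp (T := 1) 2 (-(m : ℤ) - 1),
    coeFn_mulC (fourier m) φ] with t h1 h2 h3
  have : conj (fourier (-(m : ℤ) - 1) t : ℂ) = χ t * fourier (m : ℤ) t := by
    rw [← fourier_neg, show -(-(m : ℤ) - 1) = 1 + m by ring, fourier_add, fourier_eq_χC]; rfl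
  rw [h1, h2, h3, this]
  ring

/-! ### The Blaschke factor and the Cauchy kernel on the circle -/

lemma χ_mul_conj (t : T) : χ t * conj (χ t) = 1 := by
  rw [mul_conj, normSq_eq_norm_sq, norm_χ]; simp

lemma kernel_denom_ne {a : ℂ} (ha : a ∈ disc) (t : T) : 1 - conj a * χ t ≠ 0 :=
  one_sub_ne_zero ha (norm_χ t).le

lemma kernel_conj_denom_ne {a : ℂ} (ha : a ∈ disc) (t : T) : 1 - a * conj (χ t) ≠ 0 := by
  intro h
  apply kernel_denom_ne ha t
  have := congrArg conj h
  simpa using this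

/-- The boundary values of the Blaschke factor `b_a`. -/
def blaschkeC {a : ℂ} (ha : a ∈ disc) : C(T, ℂ) :=
  ⟨fun t => blaschke a (χ t),
    (continuous_χ.sub continuous_const).div
      (continuous_const.sub (continuous_const.mul continuous_χ)) (kernel_denom_ne ha)⟩

/-- The boundary values of the Cauchy kernel `1 / (1 - conj a * z)`. -/
def kernelC {a : ℂ} (ha : a ∈ disc) : C(T, ℂ) :=
  ⟨fun t => (1 - conj a * χ t)⁻¹,
    (continuous_const.sub (continuous_const.mul continuous_χ)).inv₀ (kernel_denom_ne ha)⟩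

/-- The boundary values of `1 - conj a * z`, the reciprocal of the Cauchy kernel. -/
def kernelInvC (a : ℂ) : C(T, ℂ) :=
  ⟨fun t => 1 - conj a * χ t, continuous_const.sub (continuous_const.mul continuous_χ)⟩

/-- The Cauchy kernel `1 / (1 - conj a * z)` as an element of `L²`. For `f ∈ H²` the number
`⟪kernelL2 ha, f⟫` is the value of `f` at `a`. -/
def kernelL2 {a : ℂ} (ha : a ∈ disc) : L2 := mulC (kernelC ha) oneL2

section

variable {a : ℂ} (ha : a ∈ disc)

lemma coeFn_kernelL2 : kernelL2 ha =ᵐ[σ] fun t => kernelC ha t := by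
  filter_upwards [coeFn_mulC (kernelC ha) oneL2, coeFn_oneL2] with t h1 h2
  rw [kernelL2, h1, h2, mul_one]

lemma memLp_oneL2 : MemLp oneL2 ∞ σ :=
  (memLp_congr_ae coeFn_oneL2).2 (memLp_const 1)

lemma memLp_kernelL2 : MemLp (kernelL2 ha) ∞ σ := memLp_mulC _ memLp_oneL2

lemma kernelC_mul_inv : kernelC ha * kernelInvC a = 1 := by
  ext t
  exact inv_mul_cancel₀ (kernel_denom_ne ha t)

lemma conj_kernel_mul_blaschke (t : T) :
    conj (kernelC ha t) * blaschkeC ha t = χ t * kernelC ha t := by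
  have h1 := kernel_denom_ne ha t
  have h2 := kernel_conj_denom_ne ha t
  simp only [kernelC, blaschkeC, blaschke, ContinuousMap.coe_mk, map_inv₀, map_sub, map_one,
    map_mul, conj_conj]
  have h3 : χ t - a = χ t * (1 - a * conj (χ t)) := by linear_combination a * χ_mul_conj t
  rw [h3]
  field_simp

lemma conj_blaschke_mul_blaschke (t : T) : conj (blaschkeC ha t) * blaschkeC ha t = 1 := by
  have h1 := kernel_denom_ne ha t
  have h2 := kernel_conj_denom_ne ha t
  simp only [blaschkeC, blaschke, ContinuousMap.coe_mk, map_div₀, map_sub, map_one,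
    map_mul, conj_conj]
  have h3 : χ t - a = χ t * (1 - a * conj (χ t)) := by linear_combination a * χ_mul_conj t
  have h4 : conj (χ t) - conj a = conj (χ t) * (1 - conj a * χ t) := by
    linear_combination conj a * χ_mul_conj t
  rw [h3, h4, div_mul_div_comm, div_eq_one_iff_eq (mul_ne_zero h2 h1)]
  linear_combination ((1 - a * conj (χ t)) * (1 - conj a * χ t)) * χ_mul_conj t

lemma star_blaschkeC_mul : star (blaschkeC ha) * blaschkeC ha = 1 := by
  ext t
  exact conj_blaschke_mul_blaschke ha t

lemma blaschkeC_mul_star : blaschkeC ha * star (blaschkeC ha) = 1 := by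
  rw [mul_comm, star_blaschkeC_mul]

lemma χ_mul_conj_blaschke (t : T) :
    χ t * conj (blaschkeC ha t) = conj (kernelC ha t) * kernelInvC a t := by
  simp only [blaschkeC, kernelC, kernelInvC, blaschke, ContinuousMap.coe_mk, map_div₀, map_inv₀,
    map_sub, map_one, map_mul, conj_conj]
  have h3 : χ t * (conj (χ t) - conj a) = 1 - conj a * χ t := by
    linear_combination χ_mul_conj t
  rw [mul_div_assoc', h3, div_eq_inv_mul]

lemma conj_kernel_eq (t : T) :
    conj (kernelC ha t) = 1 + a * conj (χ t) * conj (kernelC ha t) := by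
  have h2 := kernel_conj_denom_ne ha t
  simp only [kernelC, ContinuousMap.coe_mk, map_inv₀, map_sub, map_one, map_mul, conj_conj]
  field_simp
  ring

/-- The kernel is an affine function of the Blaschke factor, so multiplication by it preserves
`H²`. -/
lemma kernelC_eq (t : T) :
    (1 - conj a * a) * kernelC ha t = 1 + conj a * blaschkeC ha t := by
  have h1 := kernel_denom_ne ha t
  simp only [kernelC, blaschkeC, blaschke, ContinuousMap.coe_mk]
  field_simp
  ring

lemma bdry_blaschke (t : T) : bdry (blaschke a) t = blaschkeC ha t := by
  have h1 := tendsto_dilate t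
  exact HasRadialLimit.bdry_eq (Tendsto.div (h1.sub_const a)
    (tendsto_const_nhds.sub (h1.const_mul _)) (kernel_denom_ne ha t))

lemma mulC_blaschkeC_mem_H2 {f : L2} (hf : f ∈ H2) : mulC (blaschkeC ha) f ∈ H2 := by
  refine mul_mem_H2 (isInner_blaschke ha) hf ?_
  filter_upwards [coeFn_mulC (blaschkeC ha) f] with t h
  rw [h, bdry_blaschke ha]

lemma mulC_kernelC_mem_H2 {f : L2} (hf : f ∈ H2) : mulC (kernelC ha) f ∈ H2 := by
  have h0 : (1 - conj a * a) ≠ 0 :=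
    one_sub_ne_zero ha (by simpa using (le_of_lt (by simpa using ha : ‖a‖ < 1)))
  have : mulC (kernelC ha) f =
      (1 - conj a * a)⁻¹ • (f + conj a • mulC (blaschkeC ha) f) := by
    have hk : kernelC ha = (1 - conj a * a)⁻¹ • (1 + conj a • blaschkeC ha) := by
      ext t
      have := kernelC_eq ha t
      rw [ContinuousMap.smul_apply, ContinuousMap.add_apply, ContinuousMap.smul_apply,
        ContinuousMap.one_apply, smul_eq_mul, smul_eq_mul, ← this, inv_mul_cancel_left₀ h0]
    rw [hk, map_smul, map_add, map_smul, _root_.smul_apply,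
      _root_.add_apply, _root_.smul_apply, mulC_one]
  rw [this]
  exact H2.smul_mem _ (H2.add_mem hf (H2.smul_mem _ (mulC_blaschkeC_mem_H2 ha hf)))

lemma mulC_kernelInvC_apply (f : L2) : mulC (kernelInvC a) f = f - conj a • mulC χC f := by
  have hk : kernelInvC a = 1 - conj a • χC := by ext t; rfl
  rw [hk, map_sub, map_smul, _root_.sub_apply, _root_.smul_apply,
    mulC_one]

lemma mulC_kernelInvC_mem_H2 {f : L2} (hf : f ∈ H2) : mulC (kernelInvC a) f ∈ H2 := by
  rw [mulC_kernelInvC_apply]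
  exact H2.sub_mem hf (H2.smul_mem _ (mulC_χC_mem_H2 hf))

lemma kernelL2_mem_H2 : kernelL2 ha ∈ H2 := mulC_kernelC_mem_H2 ha oneL2_mem_H2

/-- Functions in `b_a H²` vanish at `a`. -/
lemma inner_kernelL2_mulC_blaschkeC {f : L2} (hf : f ∈ H2) :
    ⟪kernelL2 ha, mulC (blaschkeC ha) f⟫_ℂ = 0 := by
  refine inner_conj_χ_mul (kernelL2_mem_H2 ha) hf ?_
  filter_upwards [coeFn_kernelL2 ha, coeFn_mulC (blaschkeC ha) f] with t h1 h2
  rw [h1, h2, ← conj_kernel_mul_blaschke, mul_assoc]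

lemma inner_oneL2_mulC_χC {f : L2} (hf : f ∈ H2) : ⟪oneL2, mulC χC f⟫_ℂ = 0 := by
  refine inner_conj_χ_mul hf oneL2_mem_H2 ?_
  filter_upwards [coeFn_oneL2, coeFn_mulC χC f] with t h1 h2
  rw [h1, h2, map_one, χC_apply]
  ring

/-- The identity `conj k = 1 + a * conj χ * conj k`, integrated against `f`. -/
lemma inner_kernelL2_eq (f : L2) :
    ⟪kernelL2 ha, f⟫_ℂ = ⟪oneL2, f⟫_ℂ + a * ⟪kernelL2 ha, mulC (star χC) f⟫_ℂ := by
  have h : kernelL2 ha = oneL2 + conj a • mulC χC (kernelL2 ha) := by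
    refine Lp.ext ?_
    filter_upwards [coeFn_kernelL2 ha, Lp.coeFn_add oneL2 (conj a • mulC χC (kernelL2 ha)),
      Lp.coeFn_smul (conj a) (mulC χC (kernelL2 ha)), coeFn_mulC χC (kernelL2 ha), coeFn_oneL2]
      with t h1 h2 h3 h4 h5
    rw [h2, Pi.add_apply, h3, Pi.smul_apply, h4, h5, h1]
    have := congrArg conj (conj_kernel_eq ha t)
    simp only [map_add, map_mul, map_one, conj_conj] at this
    rw [χC_apply, smul_eq_mul, ← mul_assoc]
    exact this
  conv_lhs => rw [h]
  rw [inner_add_left, inner_smul_left, conj_conj, inner_mulC_left]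

lemma inner_kernelL2_mulC_χC {f : L2} (hf : f ∈ H2) :
    ⟪kernelL2 ha, mulC χC f⟫_ℂ = a * ⟪kernelL2 ha, f⟫_ℂ := by
  rw [inner_kernelL2_eq, inner_oneL2_mulC_χC hf, mulC_mulC]
  have : star χC * χC = 1 := by
    ext t
    rw [mul_comm]
    exact χ_mul_conj t
  rw [this, mulC_one, zero_add]

lemma inner_kernelL2_mulC_fourier {f : L2} (hf : f ∈ H2) (m : ℕ) :
    ⟪kernelL2 ha, mulC (fourier m) f⟫_ℂ = a ^ m * ⟪kernelL2 ha, f⟫_ℂ := by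
  induction m with
  | zero =>
    have : (fourier ((0 : ℕ) : ℤ) : C(T, ℂ)) = 1 := by ext t; rw [Nat.cast_zero, fourier_zero]; rfl
    rw [this, mulC_one, pow_zero, one_mul]
  | succ m ih =>
    have : (fourier ((m + 1 : ℕ) : ℤ) : C(T, ℂ)) = χC * fourier (m : ℤ) := by
      ext t
      rw [Nat.cast_add, Nat.cast_one, fourier_add, fourier_eq_χC, mul_comm]; rfl
    rw [this, ← mulC_mulC, inner_kernelL2_mulC_χC ha (mulC_fourier_mem_H2 hf m), ih, pow_succ']
    ring

/-- Division by `b_a`: a function in `H²` that vanishes at `a` is divisible by `b_a` in `H²`. -/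
lemma mulC_star_blaschkeC_mem_H2 {f : L2} (hf : f ∈ H2) (h0 : ⟪kernelL2 ha, f⟫_ℂ = 0) :
    mulC (star (blaschkeC ha)) f ∈ H2 := by
  rw [mem_H2_iff_inner]
  intro n hn
  obtain ⟨m, rfl⟩ : ∃ m : ℕ, n = -(m : ℤ) - 1 := ⟨(-n - 1).toNat, by omega⟩
  have key : ⟪kernelL2 ha, mulC (fourier m) (mulC (kernelInvC a) f)⟫_ℂ = 0 := by
    rw [inner_kernelL2_mulC_fourier ha (mulC_kernelInvC_mem_H2 hf), mulC_kernelInvC_apply,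
      inner_sub_right, inner_smul_right, inner_kernelL2_mulC_χC ha hf, h0]
    ring
  rw [← key, inner_eq_integral, inner_eq_integral]
  refine integral_congr_ae ?_
  filter_upwards [coeFn_fourierLp (T := 1) 2 (-(m : ℤ) - 1), coeFn_mulC (star (blaschkeC ha)) f,
    coeFn_kernelL2 ha, coeFn_mulC (fourier m) (mulC (kernelInvC a) f),
    coeFn_mulC (kernelInvC a) f] with t h1 h2 h3 h4 h5
  have : conj (fourier (-(m : ℤ) - 1) t : ℂ) = χ t * fourier (m : ℤ) t := by
    rw [← fourier_neg, show -(-(m : ℤ) - 1) = 1 + m by ring, fourier_add, fourier_eq_χC]; rfl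
  rw [h1, h2, h3, h4, h5, this, ContinuousMap.star_apply, ← starRingEnd_apply]
  linear_combination (fourier (m : ℤ) t * f t) * χ_mul_conj_blaschke ha t

lemma inner_kernelL2_oneL2 : ⟪kernelL2 ha, oneL2⟫_ℂ = 1 := by
  rw [inner_kernelL2_eq, ← inner_mulC_left, ← inner_conj_symm (mulC χC _), inner_oneL2_mulC_χC
    (kernelL2_mem_H2 ha), map_zero, mul_zero, add_zero, oneL2, inner_self_eq_norm_sq_to_K,
    orthonormal_fourier.1 0]
  simp

lemma kernelL2_ne_zero : kernelL2 ha ≠ 0 := fun h => by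
  have := inner_kernelL2_oneL2 ha
  rw [h, inner_zero_left] at this
  exact zero_ne_one this

lemma inner_kernelL2_self_ne : ⟪kernelL2 ha, kernelL2 ha⟫_ℂ ≠ 0 :=
  inner_self_ne_zero.2 (kernelL2_ne_zero ha)

/-- Evaluation at `a` is multiplicative on `H²`. Equivalently, the Toeplitz operator with symbol
`conj h` maps the kernel at `a` to `conj (h a)` times itself. -/
lemma inner_conjFun_mul_kernelL2 {g h : L2} (hg : g ∈ H2) (hh : h ∈ H2) :
    ⟪g, mulC (kernelC ha) (conjFun h)⟫_ℂ = ⟪g, kernelL2 ha⟫_ℂ * conj ⟪kernelL2 ha, h⟫_ℂ := by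
  set c := ⟪kernelL2 ha, h⟫_ℂ with hc
  -- `h = h(a) + b_a h₁`, and the second term contributes the mean of `χ k g h₁`.
  have h0 : ⟪kernelL2 ha, h - c • oneL2⟫_ℂ = 0 := by
    rw [inner_sub_right, inner_smul_right, inner_kernelL2_oneL2, ← hc, mul_one, sub_self]
  have hmem := mulC_star_blaschkeC_mem_H2 ha (H2.sub_mem hh (H2.smul_mem c oneL2_mem_H2)) h0
  set h₁ := mulC (star (blaschkeC ha)) (h - c • oneL2) with hh₁
  have hdec : h = c • oneL2 + mulC (blaschkeC ha) h₁ := by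
    rw [hh₁, mulC_mulC, blaschkeC_mul_star, mulC_one, add_sub_cancel]
  have hsplit : mulC (kernelC ha) (conjFun h) =
      conj c • kernelL2 ha + mulC (kernelC ha) (conjFun (mulC (blaschkeC ha) h₁)) := by
    refine Lp.ext ?_
    have e1 : h =ᵐ[σ] (c • oneL2 + mulC (blaschkeC ha) h₁ : L2) := by rw [← hdec]
    filter_upwards [e1, Lp.coeFn_add (c • oneL2) (mulC (blaschkeC ha) h₁),
      Lp.coeFn_smul c oneL2, coeFn_oneL2, coeFn_mulC (kernelC ha) (conjFun h), coeFn_conjFun h,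
      Lp.coeFn_add (conj c • kernelL2 ha)
        (mulC (kernelC ha) (conjFun (mulC (blaschkeC ha) h₁))),
      Lp.coeFn_smul (conj c) (kernelL2 ha), coeFn_kernelL2 ha,
      coeFn_mulC (kernelC ha) (conjFun (mulC (blaschkeC ha) h₁)),
      coeFn_conjFun (mulC (blaschkeC ha) h₁)] with t h1 h2 h3 h4 h5 h6 h7 h8 h9 h10 h11
    rw [h5, h6, h7, Pi.add_apply, h8, Pi.smul_apply, h9, h10, h11, h1, h2, Pi.add_apply, h3,
      Pi.smul_apply, h4, smul_eq_mul, smul_eq_mul, map_add, map_mul, map_one]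
    ring
  have hzero : ⟪mulC (kernelC ha) (conjFun (mulC (blaschkeC ha) h₁)), g⟫_ℂ = 0 := by
    refine inner_conj_χ_mul (mulC_kernelC_mem_H2 ha hg) hmem ?_
    filter_upwards [coeFn_mulC (kernelC ha) (conjFun (mulC (blaschkeC ha) h₁)),
      coeFn_conjFun (mulC (blaschkeC ha) h₁), coeFn_mulC (blaschkeC ha) h₁,
      coeFn_mulC (kernelC ha) g] with t h1 h2 h3 h4
    rw [h1, h2, h3, h4, map_mul, conj_conj]
    linear_combination (h₁ t * g t) * conj_kernel_mul_blaschke ha t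
  rw [hsplit, inner_add_right, inner_smul_right, ← inner_conj_symm g (mulC _ _), hzero, map_zero,
    add_zero, mul_comm]

end

/-! ### The backward shift associated with a Blaschke factor -/

section

variable {a : ℂ} (ha : a ∈ disc)

/-- The coefficient of the kernel in the decomposition `f = c k + b_a f₁`. -/
def kernelCoeff (f : L2) : ℂ := ⟪kernelL2 ha, f⟫_ℂ / ⟪kernelL2 ha, kernelL2 ha⟫_ℂ

/-- The backward shift associated with `b_a`: in the decomposition `f = c k + b_a f₁` of `L²`, where
`k` is the kernel at `a` and `b_a f₁` is orthogonal to it, this is the map `f ↦ f₁`. -/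
def backShift : L2 →L[ℂ] L2 :=
  (mulC (star (blaschkeC ha))).comp (ContinuousLinearMap.id ℂ L2 -
    ((⟪kernelL2 ha, kernelL2 ha⟫_ℂ)⁻¹ • innerSL ℂ (kernelL2 ha)).smulRight (kernelL2 ha))

lemma backShift_apply (f : L2) :
    backShift ha f = mulC (star (blaschkeC ha)) (f - kernelCoeff ha f • kernelL2 ha) := by
  rw [kernelCoeff, div_eq_inv_mul]; rfl

lemma kernelCoeff_smul_add (f : L2) :
    kernelCoeff ha f • kernelL2 ha + mulC (blaschkeC ha) (backShift ha f) = f := by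
  rw [backShift_apply, mulC_mulC, blaschkeC_mul_star, mulC_one, add_sub_cancel]

lemma inner_kernelL2_sub (f : L2) :
    ⟪kernelL2 ha, f - kernelCoeff ha f • kernelL2 ha⟫_ℂ = 0 := by
  rw [inner_sub_right, inner_smul_right, kernelCoeff, div_mul_cancel₀ _ (inner_kernelL2_self_ne ha),
    sub_self]

lemma backShift_mem_H2 {f : L2} (hf : f ∈ H2) : backShift ha f ∈ H2 := by
  rw [backShift_apply]
  exact mulC_star_blaschkeC_mem_H2 ha (H2.sub_mem hf (H2.smul_mem _ (kernelL2_mem_H2 ha)))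
    (inner_kernelL2_sub ha f)

lemma memLp_backShift {f : L2} (hf : MemLp f ∞ σ) : MemLp (backShift ha f) ∞ σ := by
  rw [backShift_apply]
  refine memLp_mulC _ ?_
  refine (memLp_congr_ae (Lp.coeFn_sub _ _)).2 (hf.sub ?_)
  exact (memLp_congr_ae (Lp.coeFn_smul _ _)).2 ((memLp_kernelL2 ha).const_smul _)

lemma norm_mulC_of_star_mul {m : C(T, ℂ)} (hm : star m * m = 1) (f : L2) :
    ‖mulC m f‖ = ‖f‖ := by
  have : ⟪mulC m f, mulC m f⟫_ℂ = ⟪f, f⟫_ℂ := by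
    rw [inner_mulC_left, mulC_mulC, hm, mulC_one]
  rw [norm_eq_sqrt_re_inner (𝕜 := ℂ), this, ← norm_eq_sqrt_re_inner]

lemma norm_backShift_le (f : L2) : ‖backShift ha f‖ ≤ ‖f‖ := by
  rw [backShift_apply, norm_mulC_of_star_mul (by rw [star_star, blaschkeC_mul_star])]
  have h : ⟪kernelCoeff ha f • kernelL2 ha, f - kernelCoeff ha f • kernelL2 ha⟫_ℂ = 0 := by
    rw [inner_smul_left, inner_kernelL2_sub, mul_zero]
  have := norm_add_sq_eq_norm_sq_add_norm_sq_of_inner_eq_zero _ _ h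
  rw [add_sub_cancel] at this
  nlinarith [norm_nonneg f, norm_nonneg (f - kernelCoeff ha f • kernelL2 ha),
    norm_nonneg (kernelCoeff ha f • kernelL2 ha)]

/-- On `H²` the backward shift is adjoint to multiplication by `b_a`. -/
lemma inner_mulC_blaschkeC_right (g : L2) {x : L2} (hx : x ∈ H2) :
    ⟪g, mulC (blaschkeC ha) x⟫_ℂ = ⟪backShift ha g, x⟫_ℂ := by
  conv_lhs => rw [← kernelCoeff_smul_add ha g]
  rw [inner_add_left, inner_smul_left, inner_kernelL2_mulC_blaschkeC ha hx, mul_zero, zero_add,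
    inner_mulC_left, mulC_mulC, star_blaschkeC_mul, mulC_one]

lemma backShift_mulC_blaschkeC {f : L2} (hf : f ∈ H2) :
    backShift ha (mulC (blaschkeC ha) f) = f := by
  rw [backShift_apply, kernelCoeff, inner_kernelL2_mulC_blaschkeC ha hf, zero_div, zero_smul,
    sub_zero, mulC_mulC, star_blaschkeC_mul, mulC_one]

lemma iterate_mulC_mem_H2 {f : L2} (hf : f ∈ H2) (n : ℕ) :
    (mulC (blaschkeC ha))^[n] f ∈ H2 := by
  induction n with
  | zero => exact hf
  | succ n ih => rw [Function.iterate_succ_apply']; exact mulC_blaschkeC_mem_H2 ha ih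

lemma norm_iterate_mulC (f : L2) (n : ℕ) : ‖(mulC (blaschkeC ha))^[n] f‖ = ‖f‖ := by
  induction n with
  | zero => rfl
  | succ n ih =>
    rw [Function.iterate_succ_apply', norm_mulC_of_star_mul (star_blaschkeC_mul ha), ih]

lemma iterate_backShift_mem_H2 {f : L2} (hf : f ∈ H2) (n : ℕ) :
    (backShift ha)^[n] f ∈ H2 := by
  induction n with
  | zero => exact hf
  | succ n ih => rw [Function.iterate_succ_apply']; exact backShift_mem_H2 ha ih

lemma memLp_iterate_backShift {f : L2} (hf : MemLp f ∞ σ) (n : ℕ) :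
    MemLp ((backShift ha)^[n] f) ∞ σ := by
  induction n with
  | zero => exact hf
  | succ n ih => rw [Function.iterate_succ_apply']; exact memLp_backShift ha ih

lemma inner_iterate_mulC_right (g : L2) {x : L2} (hx : x ∈ H2) (n : ℕ) :
    ⟪g, (mulC (blaschkeC ha))^[n] x⟫_ℂ = ⟪(backShift ha)^[n] g, x⟫_ℂ := by
  induction n generalizing g with
  | zero => rfl
  | succ n ih =>
    rw [Function.iterate_succ_apply', inner_mulC_blaschkeC_right ha g (iterate_mulC_mem_H2 ha hx n),
      ih, Function.iterate_succ_apply]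

lemma norm_iterate_backShift_le (f : L2) (n : ℕ) : ‖(backShift ha)^[n] f‖ ≤ ‖f‖ := by
  induction n with
  | zero => rfl
  | succ n ih =>
    rw [Function.iterate_succ_apply']
    exact (norm_backShift_le ha _).trans ih

end

/-! ### Strong convergence of the powers of the backward shift -/

section

variable {a : ℂ} (ha : a ∈ disc)

lemma blaschkeC_injective : Function.Injective (blaschkeC ha) := by
  intro s t h
  have h1 := kernel_denom_ne ha s
  have h2 := kernel_denom_ne ha t
  have h0 : (1 - conj a * a) ≠ 0 :=
    one_sub_ne_zero ha (by simpa using (le_of_lt (by simpa using ha : ‖a‖ < 1)))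
  change (χ s - a) / (1 - conj a * χ s) = (χ t - a) / (1 - conj a * χ t) at h
  rw [div_eq_div_iff h1 h2] at h
  have h3 : (1 - conj a * a) * (χ s - χ t) = 0 := by linear_combination h
  have h4 : χ s = χ t := sub_eq_zero.1 ((mul_eq_zero.1 h3).resolve_left h0)
  exact AddCircle.injective_toCircle one_ne_zero (Subtype.ext h4)

/-- By the Stone–Weierstrass theorem, a closed subspace of `L²` that reduces multiplication by `b_a`
is invariant under multiplication by every continuous function. -/
lemma mulC_mem_of_reducing {N : Submodule ℂ L2} (hN : IsClosed (N : Set L2))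
    (h1 : ∀ f ∈ N, mulC (blaschkeC ha) f ∈ N) (h2 : ∀ f ∈ N, mulC (star (blaschkeC ha)) f ∈ N)
    (m : C(T, ℂ)) {f : L2} (hf : f ∈ N) : mulC m f ∈ N := by
  have htop : (StarAlgebra.adjoin ℂ {blaschkeC ha}).topologicalClosure = ⊤ := by
    refine ContinuousMap.starSubalgebra_topologicalClosure_eq_top_of_separatesPoints _ ?_
    intro s t hst
    exact ⟨_, ⟨blaschkeC ha, StarAlgebra.subset_adjoin ℂ _ rfl, rfl⟩,
      (blaschkeC_injective ha).ne hst⟩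
  have hm : m ∈ closure ((StarAlgebra.adjoin ℂ {blaschkeC ha} : Set C(T, ℂ))) := by
    rw [← StarSubalgebra.topologicalClosure_coe, htop]
    trivial
  have hcl : IsClosed {m : C(T, ℂ) | mulC m f ∈ N} :=
    hN.preimage (mulC.flip f).continuous
  refine closure_minimal (fun p hp => ?_) hcl hm
  suffices ∀ g ∈ N, mulC p g ∈ N ∧ mulC (star p) g ∈ N from (this f hf).1
  induction hp using StarAlgebra.adjoin_induction with
  | mem x hx =>
    rw [Set.mem_singleton_iff] at hx
    subst hx
    exact fun g hg => ⟨h1 g hg, h2 g hg⟩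
  | algebraMap r =>
    intro g hg
    rw [Algebra.algebraMap_eq_smul_one, star_smul, star_one, map_smul, map_smul,
      _root_.smul_apply, _root_.smul_apply, mulC_one]
    exact ⟨N.smul_mem _ hg, N.smul_mem _ hg⟩
  | add x y _ _ hx hy =>
    intro g hg
    rw [star_add, map_add, map_add]
    exact ⟨N.add_mem (hx g hg).1 (hy g hg).1, N.add_mem (hx g hg).2 (hy g hg).2⟩
  | mul x y _ _ hx hy =>
    intro g hg
    rw [star_mul, ← mulC_mulC, ← mulC_mulC]
    exact ⟨(hx _ (hy g hg).1).1, (hy _ (hx g hg).2).2⟩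
  | star x _ hx =>
    intro g hg
    rw [star_star]
    exact (hx g hg).symm

/-- The orthogonal system `b_a ^ j k`, `j ≥ 0`, of `H²`, where `k` is the kernel at `a`. -/
def takenaka (j : ℕ) : L2 := (mulC (blaschkeC ha))^[j] (kernelL2 ha)

lemma takenaka_mem_H2 (j : ℕ) : takenaka ha j ∈ H2 :=
  iterate_mulC_mem_H2 ha (kernelL2_mem_H2 ha) j

lemma takenaka_succ (j : ℕ) : takenaka ha (j + 1) = mulC (blaschkeC ha) (takenaka ha j) :=
  Function.iterate_succ_apply' _ _ _

/-- A function in `H²` orthogonal to every `b_a ^ j k` vanishes: such functions form a subspace of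
`H²` that reduces multiplication by `b_a`, so it is invariant under all negative powers of `χ`. -/
lemma eq_zero_of_inner_takenaka {f : L2} (hf : f ∈ H2)
    (h : ∀ j, ⟪takenaka ha j, f⟫_ℂ = 0) : f = 0 := by
  let N : Submodule ℂ L2 := H2 ⊓ (Submodule.span ℂ (Set.range (takenaka ha)))ᗮ
  have hmem : ∀ g, g ∈ N ↔ g ∈ H2 ∧ ∀ j, ⟪takenaka ha j, g⟫_ℂ = 0 := by
    intro g
    refine and_congr Iff.rfl ⟨fun hg j => hg _ (Submodule.subset_span ⟨j, rfl⟩), fun hg => ?_⟩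
    rw [SetLike.mem_coe, Submodule.mem_orthogonal]
    intro x hx
    induction hx using Submodule.span_induction with
    | mem x hx => obtain ⟨j, rfl⟩ := hx; exact hg j
    | zero => exact inner_zero_left _
    | add x y _ _ hx hy => rw [inner_add_left, hx, hy, add_zero]
    | smul c x _ hx => rw [inner_smul_left, hx, mul_zero]
  have hN : IsClosed (N : Set L2) := isClosed_H2.inter (Submodule.isClosed_orthogonal _)
  have h1 : ∀ g ∈ N, mulC (blaschkeC ha) g ∈ N := by
    intro g hg
    obtain ⟨hg1, hg2⟩ := (hmem g).1 hg
    refine (hmem _).2 ⟨mulC_blaschkeC_mem_H2 ha hg1, fun j => ?_⟩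
    rcases j with _ | j
    · exact inner_kernelL2_mulC_blaschkeC ha hg1
    · rw [takenaka_succ, inner_mulC_left, mulC_mulC, star_blaschkeC_mul, mulC_one, hg2 j]
  have h2 : ∀ g ∈ N, mulC (star (blaschkeC ha)) g ∈ N := by
    intro g hg
    obtain ⟨hg1, hg2⟩ := (hmem g).1 hg
    refine (hmem _).2 ⟨mulC_star_blaschkeC_mem_H2 ha hg1 (hg2 0), fun j => ?_⟩
    rw [← inner_mulC_left, ← takenaka_succ, hg2]
  have hfN : f ∈ N := (hmem f).2 ⟨hf, h⟩
  refine eq_zero_of_fourierCoeff fun n => ?_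
  have := inner_mulC_left (fourier (n + 1)) (fourierLp 2 (-1)) f
  rw [mulC_fourier, add_neg_cancel_right] at this
  rw [this]
  exact mem_H2_iff_inner.1 ((hmem _).1 (mulC_mem_of_reducing ha hN h1 h2 _ hfN)).1 _ (by omega)

instance : CompleteSpace H2 := isClosed_H2.completeSpace_coe

lemma mem_closure_span_takenaka {f : L2} (hf : f ∈ H2) :
    f ∈ (Submodule.span ℂ (Set.range (takenaka ha))).topologicalClosure := by
  set E := (Submodule.span ℂ (Set.range (takenaka ha))).topologicalClosure with hE
  have hle : E ≤ H2 := by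
    refine Submodule.topologicalClosure_minimal _ (Submodule.span_le.2 ?_) isClosed_H2
    rintro _ ⟨j, rfl⟩
    exact takenaka_mem_H2 ha j
  have hp : E.starProjection f ∈ E := E.starProjection_apply_mem f
  have h0 : f - E.starProjection f = 0 := by
    refine eq_zero_of_inner_takenaka ha (H2.sub_mem hf (hle hp)) fun j => ?_
    exact E.sub_starProjection_mem_orthogonal f _
      (Submodule.le_topologicalClosure _ (Submodule.subset_span ⟨j, rfl⟩))
  rw [sub_eq_zero.1 h0]
  exact hp

lemma backShift_kernelL2 : backShift ha (kernelL2 ha) = 0 := by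
  rw [backShift_apply, kernelCoeff, div_self (inner_kernelL2_self_ne ha), one_smul, sub_self,
    map_zero]

lemma iterate_backShift_zero (n : ℕ) : (backShift ha)^[n] 0 = 0 :=
  Function.iterate_fixed (map_zero _) n

lemma iterate_backShift_takenaka {j n : ℕ} (h : j < n) :
    (backShift ha)^[n] (takenaka ha j) = 0 := by
  induction n generalizing j with
  | zero => omega
  | succ n ih =>
    rw [Function.iterate_succ_apply]
    rcases j with _ | j
    · change (backShift ha)^[n] (backShift ha (kernelL2 ha)) = 0
      rw [backShift_kernelL2, iterate_backShift_zero]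
    · rw [takenaka_succ, backShift_mulC_blaschkeC ha (takenaka_mem_H2 ha j), ih (by omega)]

/-- The powers of the backward shift tend to zero strongly on `H²`. -/
lemma tendsto_iterate_backShift {f : L2} (hf : f ∈ H2) :
    Tendsto (fun n => (backShift ha)^[n] f) atTop (𝓝 0) := by
  have hspan : ∀ p ∈ Submodule.span ℂ (Set.range (takenaka ha)),
      ∀ᶠ n in atTop, (backShift ha)^[n] p = 0 := by
    intro p hp
    induction hp using Submodule.span_induction with
    | mem x hx =>
      obtain ⟨j, rfl⟩ := hx
      filter_upwards [eventually_gt_atTop j] with n hn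
      exact iterate_backShift_takenaka ha hn
    | zero => exact Eventually.of_forall (iterate_backShift_zero ha)
    | add x y _ _ hx hy =>
      filter_upwards [hx, hy] with n h1 h2
      rw [iterate_map_add, h1, h2, add_zero]
    | smul c x _ hx =>
      filter_upwards [hx] with n h1
      have h2 : (backShift ha)^[n] (c • x) = c • (backShift ha)^[n] x := by
        rw [← FunLike.coe_pow_eq_iterate, map_smul]
      rw [h2, h1, smul_zero]
  rw [Metric.tendsto_nhds]
  intro ε hε
  have hmem := mem_closure_span_takenaka ha hf
  rw [← SetLike.mem_coe, Submodule.topologicalClosure_coe, Metric.mem_closure_iff] at hmem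
  obtain ⟨p, hp, hpe⟩ := hmem ε hε
  filter_upwards [hspan p hp] with n hn
  rw [dist_eq_norm, sub_zero, ← sub_zero ((backShift ha)^[n] f), ← hn, ← iterate_map_sub]
  rw [dist_eq_norm] at hpe
  exact (norm_iterate_backShift_le ha _ n).trans_lt hpe

end

/-! ### Bounded functions are dense in the model space -/

/-- The subspace of bounded functions in `L²`. -/
def boundedL2 : Submodule ℂ L2 where
  carrier := {f | MemLp f ∞ σ}
  add_mem' {f g} hf hg := (memLp_congr_ae (Lp.coeFn_add f g)).2 (hf.add hg)
  zero_mem' := (memLp_congr_ae (Lp.coeFn_zero ℂ 2 σ)).2 MemLp.zero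
  smul_mem' c f hf := (memLp_congr_ae (Lp.coeFn_smul c f)).2 (hf.const_smul c)

lemma mem_boundedL2 {f : L2} : f ∈ boundedL2 ↔ MemLp f ∞ σ := Iff.rfl

section

variable {w : ℂ → ℂ} (hw : IsInner w)

/-- Multiplication by the boundary function of an inner function. -/
def innerMul : L2 →L[ℂ] L2 := mulLinf hw.memLp_bdry.toLp

/-- Multiplication by the complex conjugate of the boundary function of an inner function. -/
def innerConjMul : L2 →L[ℂ] L2 := mulLinf hw.memLp_bdry.star.toLp

lemma coeFn_innerMul (f : L2) : innerMul hw f =ᵐ[σ] fun t => bdry w t * f t := by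
  filter_upwards [coeFn_mulLinf hw.memLp_bdry.toLp f, hw.memLp_bdry.coeFn_toLp] with t h1 h2
  rw [innerMul, h1, h2]

lemma coeFn_innerConjMul (f : L2) :
    innerConjMul hw f =ᵐ[σ] fun t => conj (bdry w t) * f t := by
  filter_upwards [coeFn_mulLinf hw.memLp_bdry.star.toLp f, hw.memLp_bdry.star.coeFn_toLp]
    with t h1 h2
  rw [innerConjMul, h1, h2]; rfl

lemma inner_innerMul_left (f g : L2) : ⟪innerMul hw f, g⟫_ℂ = ⟪f, innerConjMul hw g⟫_ℂ := by
  rw [inner_eq_integral, inner_eq_integral]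
  refine integral_congr_ae ?_
  filter_upwards [coeFn_innerMul hw f, coeFn_innerConjMul hw g] with t h1 h2
  rw [h1, h2, map_mul]
  ring

lemma innerConjMul_innerMul (f : L2) : innerConjMul hw (innerMul hw f) = f := by
  refine Lp.ext ?_
  filter_upwards [coeFn_innerMul hw f, coeFn_innerConjMul hw (innerMul hw f), hw.norm_bdry]
    with t h1 h2 h3
  rw [h2, h1, ← mul_assoc, mul_comm (conj _), mul_conj, normSq_eq_norm_sq, h3]
  simp

lemma memLp_innerMul {f : L2} (hf : MemLp f ∞ σ) : MemLp (innerMul hw f) ∞ σ :=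
  (memLp_congr_ae (coeFn_innerMul hw f)).2 (hf.mul (r := ∞) hw.memLp_bdry)

lemma innerMul_mem_H2 {f : L2} (hf : f ∈ H2) : innerMul hw f ∈ H2 :=
  mul_mem_H2 hw hf (coeFn_innerMul hw f)

lemma mem_modelSpace_iff {f : L2} :
    f ∈ modelSpace w ↔ f ∈ H2 ∧ ∀ h ∈ H2, ⟪innerMul hw h, f⟫_ℂ = 0 := by
  refine and_congr Iff.rfl ⟨fun hf h hh => hf _ ⟨h, hh, coeFn_innerMul hw h⟩, fun hf => ?_⟩
  rw [SetLike.mem_coe, Submodule.mem_orthogonal]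
  rintro g ⟨h, hh, hg⟩
  rw [← hf h hh]
  congr 1
  exact Lp.ext (hg.trans (coeFn_innerMul hw h).symm)

/-- An `H²` function with finitely many nonzero Fourier coefficients is bounded. -/
lemma memLp_top_of_fourierCoeff {q : L2} (hq : q ∈ H2) (m : ℕ)
    (h : ∀ n : ℤ, (m : ℤ) < n → ⟪fourierLp 2 n, q⟫_ℂ = 0) : MemLp q ∞ σ := by
  have : q = ∑ l ∈ Finset.range (m + 1), ⟪fourierLp 2 (l : ℤ), q⟫_ℂ • fourierLp 2 (l : ℤ) := by
    rw [← sub_eq_zero]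
    refine eq_zero_of_fourierCoeff fun n => ?_
    rw [inner_sub_right, inner_sum]
    simp only [inner_smul_right, orthonormal_iff_ite.1 orthonormal_fourier]
    by_cases hn : 0 ≤ n ∧ n ≤ m
    · obtain ⟨k, rfl⟩ := Int.eq_ofNat_of_zero_le hn.1
      rw [Finset.sum_eq_single k]
      · simp
      · intro b _ hb
        rw [if_neg (by omega), mul_zero]
      · intro hk
        exact absurd (Finset.mem_range.2 (by omega)) hk
    · have h0 : ⟪fourierLp 2 n, q⟫_ℂ = 0 := by
        rcases lt_or_ge n 0 with hn' | hn'
        · exact mem_H2_iff_inner.1 hq n hn'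
        · exact h n (by omega)
      rw [h0, zero_sub, neg_eq_zero]
      refine Finset.sum_eq_zero fun b hb => ?_
      rw [Finset.mem_range] at hb
      rw [if_neg (by omega), mul_zero]
  rw [this, ← mem_boundedL2]
  refine boundedL2.sum_mem fun l _ => boundedL2.smul_mem _ ?_
  have := memLp_mulC (fourier (l : ℤ)) memLp_oneL2
  rwa [oneL2, mulC_fourier, add_zero] at this

/-- The orthogonal projection onto `K_w` of a monomial is bounded: it is `χ ^ m - w q`, where `q` is
the projection of `conj w * χ ^ m` onto `H²`, a polynomial of degree at most `m`. -/
lemma exists_bounded_projection (m : ℕ) : ∃ q ∈ H2,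
    fourierLp 2 (m : ℤ) - innerMul hw q ∈ modelSpace w ∧
      MemLp (fourierLp 2 (m : ℤ) - innerMul hw q : L2) ∞ σ := by
  set x : L2 := innerConjMul hw (fourierLp 2 (m : ℤ)) with hx
  set q : L2 := H2.starProjection x with hq
  have hq2 : q ∈ H2 := H2.starProjection_apply_mem x
  have horth : ∀ h ∈ H2, ⟪h, x - q⟫_ℂ = 0 := fun h hh =>
    H2.sub_starProjection_mem_orthogonal x h hh
  refine ⟨q, hq2, (mem_modelSpace_iff hw).2 ⟨?_, fun h hh => ?_⟩, ?_⟩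
  · exact H2.sub_mem (fourierLp_mem_H2 m) (innerMul_mem_H2 hw hq2)
  · rw [inner_innerMul_left, map_sub, innerConjMul_innerMul, ← hx, horth h hh]
  · have hqb : MemLp q ∞ σ := by
      refine memLp_top_of_fourierCoeff hq2 m fun n hn => ?_
      obtain ⟨l, rfl⟩ := Int.eq_ofNat_of_zero_le (show 0 ≤ n by omega)
      have h1 := horth _ (fourierLp_mem_H2 l)
      rw [inner_sub_right, sub_eq_zero] at h1
      have h2 : innerMul hw (fourierLp 2 (l : ℤ)) =
          mulC (fourier (l : ℤ)) (innerMul hw oneL2) := by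
        refine Lp.ext ?_
        filter_upwards [coeFn_innerMul hw (fourierLp 2 (l : ℤ)), coeFn_fourierLp (T := 1) 2 (l : ℤ),
          coeFn_mulC (fourier (l : ℤ)) (innerMul hw oneL2), coeFn_innerMul hw oneL2, coeFn_oneL2]
          with t h1 h2 h3 h4 h5
        rw [h1, h2, h3, h4, h5]
        ring
      rw [← h1, hx, ← inner_innerMul_left, h2, inner_mulC_left, star_fourier, mulC_fourier,
        ← inner_conj_symm, mem_H2_iff_inner.1 (innerMul_mem_H2 hw oneL2_mem_H2) _ (by omega),
        map_zero]
    refine mem_boundedL2.1 (boundedL2.sub_mem ?_ (memLp_innerMul hw hqb))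
    have := memLp_mulC (fourier (m : ℤ)) memLp_oneL2
    rwa [oneL2, mulC_fourier, add_zero] at this

end

/-- Bounded functions are dense in the model space. -/
lemma dense_bounded {w : ℂ → ℂ} (hw : IsInner w) :
    Dense {f : modelSpace w | MemLp ((f : L2) : T → ℂ) ∞ σ} := by
  let B : Submodule ℂ (modelSpace w) := boundedL2.comap (modelSpace w).subtype
  have hB : B.topologicalClosure = ⊤ := by
    rw [Submodule.topologicalClosure_eq_top_iff, Submodule.eq_bot_iff]
    intro f hf
    have hf2 := (mem_modelSpace_iff hw).1 f.2
    refine Subtype.ext (eq_zero_of_fourierCoeff fun n => ?_)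
    rcases lt_or_ge n 0 with hn | hn
    · exact mem_H2_iff_inner.1 hf2.1 n hn
    · obtain ⟨m, rfl⟩ := Int.eq_ofNat_of_zero_le hn
      obtain ⟨q, hq, h1, h2⟩ := exists_bounded_projection hw m
      have h3 : ⟪(fourierLp 2 (m : ℤ) - innerMul hw q : L2), (f : L2)⟫_ℂ = 0 := hf ⟨_, h1⟩ h2
      rwa [inner_sub_left, hf2.2 q hq, sub_zero] at h3
  exact Submodule.dense_iff_topologicalClosure_eq_top.2 hB

lemma continuous_quadForm {H : Type*} [NormedAddCommGroup H] [InnerProductSpace ℂ H]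
    (A : H →L[ℂ] H) : Continuous (quadForm A) :=
  continuous_id.inner A.continuous

/-! ### The conjugation of the model space -/

section

variable {u : ℂ → ℂ} (hu : IsInner u)

lemma inner_conjL2_conjL2 (f g : L2) : ⟪conjL2 hu f, conjL2 hu g⟫_ℂ = ⟪g, f⟫_ℂ := by
  rw [inner_eq_integral, inner_eq_integral]
  refine integral_congr_ae ?_
  filter_upwards [coeFn_conjL2 hu f, coeFn_conjL2 hu g, hu.norm_bdry] with t h1 h2 h3
  have h4 : bdry u t * conj (bdry u t) = 1 := by
    rw [mul_conj, normSq_eq_norm_sq, h3]; simp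
  rw [h1, h2]
  simp only [map_mul, conj_conj]
  linear_combination (conj (g t) * f t) * (χ t * conj (χ t)) * h4 +
    (conj (g t) * f t) * χ_mul_conj t

lemma conjL2_conjL2 (f : L2) : conjL2 hu (conjL2 hu f) = f := by
  refine Lp.ext ?_
  filter_upwards [coeFn_conjL2 hu f, coeFn_conjL2 hu (conjL2 hu f), hu.norm_bdry] with t h1 h2 h3
  have h4 : bdry u t * conj (bdry u t) = 1 := by
    rw [mul_conj, normSq_eq_norm_sq, h3]; simp
  rw [h2, h1]
  simp only [map_mul, conj_conj]
  linear_combination f t * (χ t * conj (χ t)) * h4 + f t * χ_mul_conj t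

lemma conjL2_sub (f g : L2) : conjL2 hu (f - g) = conjL2 hu f - conjL2 hu g := by
  refine Lp.ext ?_
  filter_upwards [coeFn_conjL2 hu f, coeFn_conjL2 hu g, coeFn_conjL2 hu (f - g), Lp.coeFn_sub f g,
    Lp.coeFn_sub (conjL2 hu f) (conjL2 hu g)] with t h1 h2 h3 h4 h5
  rw [h3, h4, h5, Pi.sub_apply, Pi.sub_apply, h1, h2]
  simp only [map_mul, map_sub]
  ring

lemma continuous_modelConj : Continuous (modelConj hu) := by
  have : Isometry (conjL2 hu) := by
    refine Isometry.of_dist_eq fun f g => ?_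
    rw [dist_eq_norm, dist_eq_norm, ← conjL2_sub, norm_eq_sqrt_re_inner (𝕜 := ℂ),
      inner_conjL2_conjL2, ← norm_eq_sqrt_re_inner]
  exact (this.continuous.comp continuous_subtype_val).subtype_mk _

lemma modelConj_modelConj (f : modelSpace u) : modelConj hu (modelConj hu f) = f :=
  Subtype.ext (conjL2_conjL2 hu f)

lemma inner_modelConj_modelConj (f g : modelSpace u) :
    ⟪modelConj hu f, modelConj hu g⟫_ℂ = ⟪g, f⟫_ℂ :=
  inner_conjL2_conjL2 hu f g

lemma memLp_modelConj {f : modelSpace u} (hf : MemLp ((f : L2) : T → ℂ) ∞ σ) :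
    MemLp ((modelConj hu f : L2) : T → ℂ) ∞ σ := by
  refine (memLp_congr_ae (coeFn_conjL2 hu f)).2 ?_
  have h1 : MemLp (fun t => χ t * (f : L2) t) ∞ σ :=
    hf.mul (r := ∞) (memLp_top_of_bound continuous_χ.aestronglyMeasurable 1
      (Eventually.of_forall fun t => (norm_χ t).le))
  exact h1.star.mul (r := ∞) hu.memLp_bdry

lemma isCSymmetric_iff (A : modelSpace u →L[ℂ] modelSpace u) :
    IsCSymmetric (modelConj hu) A ↔
      ∀ f g, ⟪modelConj hu f, A (modelConj hu g)⟫_ℂ = ⟪g, A f⟫_ℂ := by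
  have key : ∀ f g, ⟪modelConj hu (A (modelConj hu g)), f⟫_ℂ =
      ⟪modelConj hu f, A (modelConj hu g)⟫_ℂ := fun f g => by
    rw [← inner_modelConj_modelConj hu, modelConj_modelConj]
  refine ⟨fun h f g => ?_, fun h g => ?_⟩
  · rw [← key, ← h g, ContinuousLinearMap.adjoint_inner_left]
  · refine ext_inner_right ℂ fun f => ?_
    rw [key, h, ContinuousLinearMap.adjoint_inner_left]

/-! ### Truncated Toeplitz operators satisfy both conditions -/

lemma isTruncatedToeplitz_iff (A : modelSpace u →L[ℂ] modelSpace u) :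
    IsTruncatedToeplitz u A ↔ ∃ φ : L2, ∀ (f : modelSpace u) (hf : MemLp ((f : L2) : T → ℂ) ∞ σ)
      (g : modelSpace u), ⟪g, A f⟫_ℂ = ⟪(g : L2), symMul φ f hf⟫_ℂ := by
  refine exists_congr fun φ => forall₂_congr fun f hf => ⟨fun h g => ?_, fun h => ?_⟩
  · rw [h]
    exact Submodule.inner_orthogonalProjectionOnto_eq_of_mem_left _ _
  · refine ext_inner_left ℂ fun g => (h g).trans ?_
    exact (Submodule.inner_orthogonalProjectionOnto_eq_of_mem_left _ _).symm

lemma IsTruncatedToeplitz.isCSymmetric {A : modelSpace u →L[ℂ] modelSpace u}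
    (hA : IsTruncatedToeplitz u A) : IsCSymmetric (modelConj hu) A := by
  obtain ⟨φ, hφ⟩ := (isTruncatedToeplitz_iff A).1 hA
  rw [isCSymmetric_iff]
  have hC := continuous_modelConj hu
  intro f g
  refine (dense_bounded hu).induction
    (P := fun f => ⟪modelConj hu f, A (modelConj hu g)⟫_ℂ = ⟪g, A f⟫_ℂ) (fun f hf => ?_)
    (isClosed_eq (hC.inner continuous_const)
      (continuous_const.inner A.continuous)) f
  refine (dense_bounded hu).induction
    (P := fun g => ⟪modelConj hu f, A (modelConj hu g)⟫_ℂ = ⟪g, A f⟫_ℂ) (fun g hg => ?_)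
    (isClosed_eq (continuous_const.inner (A.continuous.comp hC))
      (Continuous.inner (𝕜 := ℂ) (E := modelSpace u) continuous_id' continuous_const)) g
  rw [hφ _ (memLp_modelConj hu hg), hφ _ hf, inner_eq_integral, inner_eq_integral]
  refine integral_congr_ae ?_
  filter_upwards [coeFn_conjL2 hu f, coeFn_conjL2 hu g, hu.norm_bdry, coeFn_symMul φ f hf,
    coeFn_symMul φ (modelConj hu g) (memLp_modelConj hu hg)] with t h1 h2 h3 h4 h5
  have h6 : bdry u t * conj (bdry u t) = 1 := by
    rw [mul_conj, normSq_eq_norm_sq, h3]; simp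
  rw [h4, h5]
  change conj (conjL2 hu f t) * (φ t * conjL2 hu g t) = _
  rw [h1, h2]
  simp only [map_mul, conj_conj]
  linear_combination (φ t * conj ((g : L2) t) * (f : L2) t) * (χ t * conj (χ t)) * h6 +
    (φ t * conj ((g : L2) t) * (f : L2) t) * χ_mul_conj t

lemma norm_conjL2 (f : L2) : ∀ᵐ t ∂σ, ‖conjL2 hu f t‖ = ‖f t‖ := by
  filter_upwards [coeFn_conjL2 hu f, hu.norm_bdry] with t h1 h2
  rw [h1, norm_mul, h2, RCLike.norm_conj, norm_mul, norm_χ, one_mul, one_mul]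

/-- For bounded `f` the quadratic form of a truncated Toeplitz operator is `∫ φ |f|²`, which depends
on `|f|` only. -/
lemma IsTruncatedToeplitz.quadForm_congr {A : modelSpace u →L[ℂ] modelSpace u}
    (hA : IsTruncatedToeplitz u A) {x y : modelSpace u} (hx : MemLp ((x : L2) : T → ℂ) ∞ σ)
    (hy : MemLp ((y : L2) : T → ℂ) ∞ σ) (h : ∀ᵐ t ∂σ, ‖(x : L2) t‖ = ‖(y : L2) t‖) :
    quadForm A x = quadForm A y := by
  obtain ⟨φ, hφ⟩ := (isTruncatedToeplitz_iff A).1 hA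
  unfold quadForm
  rw [hφ x hx, hφ y hy, inner_eq_integral, inner_eq_integral]
  refine integral_congr_ae ?_
  filter_upwards [h, coeFn_symMul φ x hx, coeFn_symMul φ y hy] with t h1 h2 h3
  have h4 : conj ((x : L2) t) * (x : L2) t = conj ((y : L2) t) * (y : L2) t := by
    rw [conj_mul', conj_mul', h1]
  rw [h2, h3]
  linear_combination φ t * h4

lemma IsTruncatedToeplitz.quadForm_modelConj {v : ℂ → ℂ} (hv : IsInner v)
    (hle : modelSpace v ≤ modelSpace u) {A : modelSpace u →L[ℂ] modelSpace u}
    (hA : IsTruncatedToeplitz u A) (f : modelSpace v) :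
    quadForm A (Submodule.inclusion hle (modelConj hv f)) =
      quadForm A (Submodule.inclusion hle f) := by
  have hQ : Continuous (quadForm A) := continuous_quadForm A
  have hi : Continuous (Submodule.inclusion hle) := continuous_inclusion hle
  have hcl : IsClosed {f | quadForm A (Submodule.inclusion hle (modelConj hv f)) =
      quadForm A (Submodule.inclusion hle f)} :=
    isClosed_eq (hQ.comp (hi.comp (continuous_modelConj hv))) (hQ.comp hi)
  have hmem : ∀ f : modelSpace v, MemLp ((f : L2) : T → ℂ) ∞ σ →
      quadForm A (Submodule.inclusion hle (modelConj hv f)) =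
        quadForm A (Submodule.inclusion hle f) := by
    intro f hf
    refine hA.quadForm_congr ?_ ?_ ?_
    · rw [Submodule.coe_inclusion]
      exact memLp_modelConj hv hf
    · rwa [Submodule.coe_inclusion]
    · rw [Submodule.coe_inclusion, Submodule.coe_inclusion]
      exact norm_conjL2 hv f
  exact (dense_bounded hv).induction hmem hcl f

end

/-! ### Invariance of the form under multiplication by the Blaschke factor -/

section

variable {u : ℂ → ℂ} (hu : IsInner u) {a : ℂ} (ha : a ∈ disc) (hua : u a = 0)

lemma bdry_eq_blaschke_mul (hu : IsInner u) (hua : u a = 0) :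
    ∀ᵐ t ∂σ, bdry u t = blaschkeC ha t * bdry (divBlaschke u a) t := by
  filter_upwards [(isInner_divBlaschke hu ha hua).hasRadialLimit_bdry,
    (isInner_blaschke ha).hasRadialLimit_bdry] with t h1 h2
  rw [← bdry_blaschke ha]
  refine HasRadialLimit.bdry_eq ((Tendsto.mul h2 h1).congr' ?_)
  filter_upwards [eventually_radius] with r hr
  exact blaschke_mul_divBlaschke ha hua (mul_χ_mem_disc hr.1 hr.2 t)

lemma innerMul_eq (h : L2) :
    innerMul hu h = mulC (blaschkeC ha) (innerMul (isInner_divBlaschke hu ha hua) h) := by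
  refine Lp.ext ?_
  filter_upwards [coeFn_innerMul hu h, coeFn_innerMul (isInner_divBlaschke hu ha hua) h,
    coeFn_mulC (blaschkeC ha) (innerMul (isInner_divBlaschke hu ha hua) h),
    bdry_eq_blaschke_mul ha hu hua] with t h1 h2 h3 h4
  rw [h1, h3, h2, h4, mul_assoc]

lemma kernelL2_mem_modelSpace (hu : IsInner u) (hua : u a = 0) : kernelL2 ha ∈ modelSpace u := by
  refine (mem_modelSpace_iff hu).2 ⟨kernelL2_mem_H2 ha, fun h hh => ?_⟩
  rw [innerMul_eq hu ha hua, ← inner_conj_symm,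
    inner_kernelL2_mulC_blaschkeC ha (innerMul_mem_H2 _ hh), map_zero]

lemma mulC_blaschkeC_mem_modelSpace (hu : IsInner u) (hua : u a = 0) {f : L2}
    (hf : f ∈ modelSpace (divBlaschke u a)) : mulC (blaschkeC ha) f ∈ modelSpace u := by
  obtain ⟨h1, h2⟩ := (mem_modelSpace_iff (isInner_divBlaschke hu ha hua)).1 hf
  refine (mem_modelSpace_iff hu).2 ⟨mulC_blaschkeC_mem_H2 ha h1, fun h hh => ?_⟩
  rw [innerMul_eq hu ha hua, inner_mulC_left, mulC_mulC, star_blaschkeC_mul, mulC_one, h2 h hh]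

lemma backShift_mem_modelSpace (hu : IsInner u) (hua : u a = 0) {f : L2}
    (hf : f ∈ modelSpace u) : backShift ha f ∈ modelSpace (divBlaschke u a) := by
  refine (mem_modelSpace_iff (isInner_divBlaschke hu ha hua)).2
    ⟨backShift_mem_H2 ha ((mem_modelSpace_iff hu).1 hf).1, fun h hh => ?_⟩
  have h1 := (modelSpace u).sub_mem hf
    ((modelSpace u).smul_mem (kernelCoeff ha f) (kernelL2_mem_modelSpace ha hu hua))
  rw [backShift_apply, ← inner_mulC_left, ← innerMul_eq hu ha hua]
  exact ((mem_modelSpace_iff hu).1 h1).2 h hh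

/-- Multiplication by `b_a` as an isometry from `K_{u / b_a}` into `K_u`. -/
def blaschkeMul (hu : IsInner u) (hua : u a = 0) :
    modelSpace (divBlaschke u a) →L[ℂ] modelSpace u :=
  ((mulC (blaschkeC ha)).comp (modelSpace (divBlaschke u a)).subtypeL).codRestrict _
    fun f => mulC_blaschkeC_mem_modelSpace ha hu hua f.2

/-- The inclusion of `K_{u / b_a}` into `K_u`. -/
def modelIncl (hu : IsInner u) (hua : u a = 0) :
    modelSpace (divBlaschke u a) →L[ℂ] modelSpace u :=
  (modelSpace (divBlaschke u a)).subtypeL.codRestrict _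
    fun f => modelSpace_divBlaschke_le hu ha hua f.2

/-- The conjugations of `K_{u / b_a}` and `K_u` differ by the Blaschke factor. -/
lemma inclusion_modelConj (f : modelSpace (divBlaschke u a)) :
    Submodule.inclusion (modelSpace_divBlaschke_le hu ha hua)
      (modelConj (isInner_divBlaschke hu ha hua) f) =
      modelConj hu (blaschkeMul ha hu hua f) := by
  refine Subtype.ext (Lp.ext ?_)
  change conjL2 (isInner_divBlaschke hu ha hua) f =ᵐ[σ] conjL2 hu (mulC (blaschkeC ha) f)
  filter_upwards [coeFn_conjL2 (isInner_divBlaschke hu ha hua) f,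
    coeFn_conjL2 hu (mulC (blaschkeC ha) f), coeFn_mulC (blaschkeC ha) f,
    bdry_eq_blaschke_mul ha hu hua] with t h1 h2 h3 h4
  rw [h1, h2, h3, h4]
  simp only [map_mul]
  linear_combination (-bdry (divBlaschke u a) t * conj (χ t) * conj ((f : L2) t)) *
    conj_blaschke_mul_blaschke ha t

/-- For a `C_u`-symmetric operator the hypothesis on the quadratic form says `Q_A (b_a f) = Q_A f`,
because `C_v f = C_u (b_a f)` for `v = u / b_a`; this is its polarized version. -/
lemma inner_blaschkeMul {A : modelSpace u →L[ℂ] modelSpace u}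
    (hA : IsCSymmetric (modelConj hu) A)
    (hQ : ∀ f : modelSpace (divBlaschke u a),
      quadForm A (Submodule.inclusion (modelSpace_divBlaschke_le hu ha hua)
        (modelConj (isInner_divBlaschke hu ha hua) f)) =
      quadForm A (Submodule.inclusion (modelSpace_divBlaschke_le hu ha hua) f))
    (f g : modelSpace (divBlaschke u a)) :
    ⟪blaschkeMul ha hu hua g, A (blaschkeMul ha hu hua f)⟫_ℂ =
      ⟪modelIncl ha hu hua g, A (modelIncl ha hu hua f)⟫_ℂ := by
  set B := blaschkeMul ha hu hua
  set I := modelIncl ha hu hua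
  let D : modelSpace (divBlaschke u a) →L[ℂ] modelSpace (divBlaschke u a) :=
    (ContinuousLinearMap.adjoint B).comp (A.comp B) -
      (ContinuousLinearMap.adjoint I).comp (A.comp I)
  have hD : ∀ f g, ⟪g, D f⟫_ℂ = ⟪B g, A (B f)⟫_ℂ - ⟪I g, A (I f)⟫_ℂ := fun f g => by
    simp only [D, _root_.sub_apply, ContinuousLinearMap.comp_apply, inner_sub_right,
      ContinuousLinearMap.adjoint_inner_right]
  have hD0 : (D : modelSpace (divBlaschke u a) →ₗ[ℂ] modelSpace (divBlaschke u a)) = 0 := by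
    rw [← inner_map_self_eq_zero]
    intro x
    have h1 := hQ x
    rw [inclusion_modelConj, quadForm, (isCSymmetric_iff hu A).1 hA] at h1
    rw [← inner_conj_symm, ContinuousLinearMap.coe_coe, hD, sub_eq_zero.2, map_zero]
    exact h1
  have h2 : D f = 0 := LinearMap.congr_fun hD0 f
  rw [← sub_eq_zero, ← hD, h2, inner_zero_right]

end

/-! ### The symbol -/

section

variable {a : ℂ} (ha : a ∈ disc)

lemma mulC_kernelC_kernelInvC (f : L2) : mulC (kernelC ha) (mulC (kernelInvC a) f) = f := by
  rw [mulC_mulC, kernelC_mul_inv, mulC_one]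

/-- Evaluation at `a` of the quotient `p / k`, by multiplicativity: `k a * (p / k) a = p a`, where
`k a` is the squared norm of the kernel. -/
lemma inner_kernelL2_kernelInvC {p : L2} (hp : p ∈ H2) :
    ⟪kernelL2 ha, kernelL2 ha⟫_ℂ * ⟪kernelL2 ha, mulC (kernelInvC a) p⟫_ℂ =
      ⟪kernelL2 ha, p⟫_ℂ := by
  have h := inner_conjFun_mul_kernelL2 ha (kernelL2_mem_H2 ha) (mulC_kernelInvC_mem_H2 (a := a) hp)
  have h2 : ⟪kernelL2 ha, mulC (kernelC ha) (conjFun (mulC (kernelInvC a) p))⟫_ℂ =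
      ⟪p, kernelL2 ha⟫_ℂ := by
    conv_rhs => rw [← mulC_kernelC_kernelInvC ha p]
    rw [inner_eq_integral, inner_eq_integral]
    refine integral_congr_ae ?_
    filter_upwards [coeFn_kernelL2 ha,
      coeFn_mulC (kernelC ha) (conjFun (mulC (kernelInvC a) p)),
      coeFn_conjFun (mulC (kernelInvC a) p), coeFn_mulC (kernelC ha) (mulC (kernelInvC a) p)]
      with t h1 h2 h3 h4
    rw [h1, h2, h3, h4, map_mul]
    ring
  have h3 := congrArg conj (h2.symm.trans h)
  rw [inner_conj_symm, map_mul, conj_conj, inner_conj_symm] at h3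
  exact h3.symm

lemma symMul_add (φ ψ f : L2) (hf : MemLp f ∞ σ) :
    symMul (φ + ψ) f hf = symMul φ f hf + symMul ψ f hf := by
  refine Lp.ext ?_
  filter_upwards [coeFn_symMul (φ + ψ) f hf, coeFn_symMul φ f hf, coeFn_symMul ψ f hf,
    Lp.coeFn_add φ ψ, Lp.coeFn_add (symMul φ f hf) (symMul ψ f hf)] with t h1 h2 h3 h4 h5
  rw [h1, h5, Pi.add_apply, h2, h3, h4, Pi.add_apply, add_mul]

lemma conjFun_conjFun (φ : L2) : conjFun (conjFun φ) = φ := by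
  refine Lp.ext ?_
  filter_upwards [coeFn_conjFun φ, coeFn_conjFun (conjFun φ)] with t h1 h2
  rw [h2, h1, conj_conj]

lemma mulC_symMul (m : C(T, ℂ)) (φ f : L2) (hf : MemLp f ∞ σ) :
    mulC m (symMul φ f hf) = symMul φ (mulC m f) (memLp_mulC m hf) := by
  refine Lp.ext ?_
  filter_upwards [coeFn_symMul φ f hf, coeFn_symMul φ (mulC m f) (memLp_mulC m hf),
    coeFn_mulC m (symMul φ f hf), coeFn_mulC m f] with t h1 h2 h3 h4
  rw [h3, h1, h2, h4]
  ring

lemma exists_iterate_mulC_symMul (m : C(T, ℂ)) (φ f : L2) (hf : MemLp f ∞ σ) (n : ℕ) :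
    ∃ h : MemLp ((mulC m)^[n] f) ∞ σ,
      (mulC m)^[n] (symMul φ f hf) = symMul φ ((mulC m)^[n] f) h := by
  induction n generalizing f with
  | zero => exact ⟨hf, rfl⟩
  | succ n ih =>
    obtain ⟨h, h1⟩ := ih (mulC m f) (memLp_mulC m hf)
    exact ⟨h, by rw [Function.iterate_succ_apply, mulC_symMul, h1]; rfl⟩

lemma symMul_smul_add (φ : L2) {c : ℂ} {f x y : L2} (hf : MemLp f ∞ σ) (hx : MemLp x ∞ σ)
    (hy : MemLp y ∞ σ) (h : f = c • x + y) :
    symMul φ f hf = c • symMul φ x hx + symMul φ y hy := by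
  subst h
  refine Lp.ext ?_
  filter_upwards [coeFn_symMul φ (c • x + y) hf, coeFn_symMul φ x hx, coeFn_symMul φ y hy,
    Lp.coeFn_add (c • x) y, Lp.coeFn_smul c x,
    Lp.coeFn_add (c • symMul φ x hx) (symMul φ y hy), Lp.coeFn_smul c (symMul φ x hx)]
    with t h1 h2 h3 h4 h5 h6 h7
  rw [h1, h4, Pi.add_apply, h5, Pi.smul_apply, h6, Pi.add_apply, h7, Pi.smul_apply, h2, h3,
    smul_eq_mul, smul_eq_mul]
  ring

/-- The form with an analytic symbol tends to zero along the iterated backward shifts. -/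
lemma tendsto_inner_symMul_of_mem_H2 {φ f g : L2} (hφ : φ ∈ H2) (hf : f ∈ H2)
    (hfb : MemLp f ∞ σ) (hgb : MemLp g ∞ σ) :
    Tendsto (fun n => ⟪(backShift ha)^[n] g,
      symMul φ ((backShift ha)^[n] f) (memLp_iterate_backShift ha hfb n)⟫_ℂ) atTop (𝓝 0) := by
  -- Move the shifts from `g` to the other side, where they become multiplication by `b_a ^ n`.
  have h1 : ∀ n, ⟪(backShift ha)^[n] g,
      symMul φ ((backShift ha)^[n] f) (memLp_iterate_backShift ha hfb n)⟫_ℂ =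
      ⟪symMul (conjFun φ) g hgb, (mulC (blaschkeC ha))^[n] ((backShift ha)^[n] f)⟫_ℂ := fun n => by
    have hfn := memLp_iterate_backShift ha hfb n
    rw [← inner_iterate_mulC_right ha g
      (symMul_mem_H2 hφ (iterate_backShift_mem_H2 ha hf n) hfn) n]
    obtain ⟨hb, h⟩ := exists_iterate_mulC_symMul (blaschkeC ha) φ _ hfn n
    rw [h, inner_symMul_swap φ _ g hb hgb]
  simp only [h1]
  have h2 : Tendsto (fun n => ‖symMul (conjFun φ) g hgb‖ * ‖(backShift ha)^[n] f‖) atTop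
      (𝓝 0) := by
    have := ((tendsto_iterate_backShift ha hf).norm).const_mul ‖symMul (conjFun φ) g hgb‖
    rwa [norm_zero, mul_zero] at this
  refine squeeze_zero_norm (fun n => ?_) h2
  rw [← norm_iterate_mulC ha ((backShift ha)^[n] f) n]
  exact norm_inner_le_norm _ _

lemma tendsto_inner_symMul_conjFun {φ f g : L2} (hφ : φ ∈ H2) (hg : g ∈ H2)
    (hfb : MemLp f ∞ σ) (hgb : MemLp g ∞ σ) :
    Tendsto (fun n => ⟪(backShift ha)^[n] g,
      symMul (conjFun φ) ((backShift ha)^[n] f) (memLp_iterate_backShift ha hfb n)⟫_ℂ)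
      atTop (𝓝 0) := by
  have h := (continuous_conj.tendsto _).comp
    (tendsto_inner_symMul_of_mem_H2 ha hφ hg hgb hfb)
  rw [map_zero] at h
  refine h.congr fun n => ?_
  rw [Function.comp_apply, inner_conj_symm,
    inner_symMul_swap (conjFun φ) _ _ _ (memLp_iterate_backShift ha hgb n), conjFun_conjFun]

/-- The symbol `p / k + conj (q / k) - c`, where `k` is the kernel at `a` and `c` is the conjugate of
the value of `q / k` at `a`. It is adapted to the kernel: compressed to `H²`, the symbol sends `k` to
`p`, and if `p a = conj (q a)`, its conjugate sends `k` to `q`. -/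
def kernelSymbol (p q : L2) : L2 :=
  (mulC (kernelInvC a) p - conj ⟪kernelL2 ha, mulC (kernelInvC a) q⟫_ℂ • oneL2) +
    conjFun (mulC (kernelInvC a) q)

lemma inner_symMul_kernelSymbol_kernelL2 {p q g : L2} (hq : q ∈ H2) (hg : g ∈ H2) :
    ⟪g, symMul (kernelSymbol ha p q) (kernelL2 ha) (memLp_kernelL2 ha)⟫_ℂ = ⟪g, p⟫_ℂ := by
  set c := conj ⟪kernelL2 ha, mulC (kernelInvC a) q⟫_ℂ with hc
  have h1 : symMul (kernelSymbol ha p q) (kernelL2 ha) (memLp_kernelL2 ha) =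
      p - c • kernelL2 ha + mulC (kernelC ha) (conjFun (mulC (kernelInvC a) q)) := by
    rw [kernelSymbol, symMul_add]
    congr 1
    · conv_rhs => rw [← mulC_kernelC_kernelInvC ha p, kernelL2, ← map_smul, ← map_sub]
      refine Lp.ext ?_
      filter_upwards [coeFn_symMul (mulC (kernelInvC a) p - c • oneL2) _ (memLp_kernelL2 ha),
        coeFn_kernelL2 ha, coeFn_mulC (kernelC ha) (mulC (kernelInvC a) p - c • oneL2)]
        with t h1 h2 h3
      rw [h1, h2, h3, mul_comm]
    · refine Lp.ext ?_
      filter_upwards [coeFn_symMul (conjFun (mulC (kernelInvC a) q)) _ (memLp_kernelL2 ha),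
        coeFn_kernelL2 ha, coeFn_mulC (kernelC ha) (conjFun (mulC (kernelInvC a) q))]
        with t h1 h2 h3
      rw [h1, h2, h3, mul_comm]
  rw [h1, inner_add_right, inner_sub_right, inner_smul_right,
    inner_conjFun_mul_kernelL2 ha hg (mulC_kernelInvC_mem_H2 hq), ← hc]
  ring

lemma conjFun_kernelSymbol {p q : L2} (hp : p ∈ H2) (hq : q ∈ H2)
    (hpq : ⟪kernelL2 ha, p⟫_ℂ = conj ⟪kernelL2 ha, q⟫_ℂ) :
    conjFun (kernelSymbol ha p q) = kernelSymbol ha q p := by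
  have hreal : conj ⟪kernelL2 ha, kernelL2 ha⟫_ℂ = ⟪kernelL2 ha, kernelL2 ha⟫_ℂ :=
    inner_conj_symm _ _
  have hc : conj ⟪kernelL2 ha, mulC (kernelInvC a) p⟫_ℂ =
      ⟪kernelL2 ha, mulC (kernelInvC a) q⟫_ℂ := by
    refine mul_left_cancel₀ (inner_kernelL2_self_ne ha) ?_
    rw [inner_kernelL2_kernelInvC ha hq, ← hreal, ← map_mul, inner_kernelL2_kernelInvC ha hp, hpq,
      conj_conj]
  rw [kernelSymbol, kernelSymbol, hc]
  set c := ⟪kernelL2 ha, mulC (kernelInvC a) q⟫_ℂ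
  set x := mulC (kernelInvC a) p
  set y := mulC (kernelInvC a) q
  refine Lp.ext ?_
  filter_upwards [coeFn_conjFun (x - conj c • oneL2 + conjFun y), coeFn_conjFun x, coeFn_conjFun y,
    Lp.coeFn_add (x - conj c • oneL2) (conjFun y), Lp.coeFn_sub x (conj c • oneL2),
    Lp.coeFn_smul (conj c) oneL2, coeFn_oneL2, Lp.coeFn_add (y - c • oneL2) (conjFun x),
    Lp.coeFn_sub y (c • oneL2), Lp.coeFn_smul c oneL2] with t h1 h2 h3 h4 h5 h6 h7 h8 h9 h10
  rw [h1, h4, Pi.add_apply, h5, Pi.sub_apply, h6, Pi.smul_apply, h7, h3, h8, Pi.add_apply, h9,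
    Pi.sub_apply, h10, Pi.smul_apply, h7, h2]
  simp only [map_add, map_sub, conj_conj, smul_eq_mul, mul_one]
  ring

/-- The companion of `inner_symMul_kernelSymbol_kernelL2` for the kernel in the other slot. -/
lemma inner_kernelL2_symMul_kernelSymbol {p q f : L2} (hp : p ∈ H2) (hq : q ∈ H2)
    (hpq : ⟪kernelL2 ha, p⟫_ℂ = conj ⟪kernelL2 ha, q⟫_ℂ) (hf : f ∈ H2) (hfb : MemLp f ∞ σ) :
    ⟪kernelL2 ha, symMul (kernelSymbol ha p q) f hfb⟫_ℂ = ⟪q, f⟫_ℂ := by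
  rw [inner_symMul_swap _ _ _ _ (memLp_kernelL2 ha), conjFun_kernelSymbol ha hp hq hpq,
    ← inner_conj_symm, inner_symMul_kernelSymbol_kernelL2 ha hp hf, inner_conj_symm]

lemma tendsto_inner_symMul_kernelSymbol {p q f g : L2} (hp : p ∈ H2) (hq : q ∈ H2) (hf : f ∈ H2)
    (hg : g ∈ H2) (hfb : MemLp f ∞ σ) (hgb : MemLp g ∞ σ) :
    Tendsto (fun n => ⟪(backShift ha)^[n] g, symMul (kernelSymbol ha p q) ((backShift ha)^[n] f)
      (memLp_iterate_backShift ha hfb n)⟫_ℂ) atTop (𝓝 0) := by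
  have h := (tendsto_inner_symMul_of_mem_H2 ha (H2.sub_mem (mulC_kernelInvC_mem_H2 (a := a) hp)
      (H2.smul_mem (conj ⟪kernelL2 ha, mulC (kernelInvC a) q⟫_ℂ) oneL2_mem_H2)) hf hfb hgb).add
    (tendsto_inner_symMul_conjFun ha (mulC_kernelInvC_mem_H2 (a := a) hq) hg hfb hgb)
  rw [add_zero] at h
  refine h.congr fun n => ?_
  rw [kernelSymbol, symMul_add, inner_add_right]

end

/-! ### Operators satisfying both conditions are truncated Toeplitz operators -/

section

variable {u : ℂ → ℂ} {a : ℂ} (ha : a ∈ disc)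

/-- The kernel at `a` as an element of the model space. -/
def kernelModel (hu : IsInner u) (hua : u a = 0) : modelSpace u :=
  ⟨kernelL2 ha, kernelL2_mem_modelSpace ha hu hua⟩

/-- The backward shift associated with `b_a` on the model space. -/
def modelShift (hu : IsInner u) (hua : u a = 0) (f : modelSpace u) :
    modelSpace (divBlaschke u a) :=
  ⟨backShift ha f, backShift_mem_modelSpace ha hu hua f.2⟩

lemma kernelModel_smul_add (hu : IsInner u) (hua : u a = 0) (f : modelSpace u) :
    f = kernelCoeff ha (f : L2) • kernelModel ha hu hua +
      blaschkeMul ha hu hua (modelShift ha hu hua f) :=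
  Subtype.ext (kernelCoeff_smul_add ha (f : L2)).symm

lemma inner_map_smul_add {H : Type*} [NormedAddCommGroup H] [InnerProductSpace ℂ H]
    (A : H →L[ℂ] H) {f g k x y : H} {c d : ℂ} (hf : f = c • k + x) (hg : g = d • k + y) :
    ⟪g, A f⟫_ℂ = c * ⟪g, A k⟫_ℂ + (conj d * ⟪k, A x⟫_ℂ + ⟪y, A x⟫_ℂ) := by
  rw [← inner_smul_left, ← inner_add_left, ← hg, hf, map_add, map_smul, inner_add_right,
    inner_smul_right]

/-- If the forms of `A` and of the symbol `φ` agree whenever one of the arguments is the kernel, and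
the form of `A` is invariant under multiplication by `b_a`, then their difference is invariant under
the backward shift. -/
lemma sub_symMul_modelShift (hu : IsInner u) (hua : u a = 0)
    {A : modelSpace u →L[ℂ] modelSpace u} {φ : L2}
    (hinv : ∀ f g : modelSpace (divBlaschke u a),
      ⟪blaschkeMul ha hu hua g, A (blaschkeMul ha hu hua f)⟫_ℂ =
        ⟪modelIncl ha hu hua g, A (modelIncl ha hu hua f)⟫_ℂ)
    (hright : ∀ g : modelSpace u, ⟪g, A (kernelModel ha hu hua)⟫_ℂ =
      ⟪(g : L2), symMul φ (kernelL2 ha) (memLp_kernelL2 ha)⟫_ℂ)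
    (hleft : ∀ (f : modelSpace u) (hf : MemLp ((f : L2) : T → ℂ) ∞ σ),
      ⟪kernelModel ha hu hua, A f⟫_ℂ = ⟪kernelL2 ha, symMul φ f hf⟫_ℂ)
    (f g : modelSpace u) (hf : MemLp ((f : L2) : T → ℂ) ∞ σ) :
    ⟪g, A f⟫_ℂ - ⟪(g : L2), symMul φ f hf⟫_ℂ =
      ⟪modelIncl ha hu hua (modelShift ha hu hua g),
        A (modelIncl ha hu hua (modelShift ha hu hua f))⟫_ℂ -
      ⟪backShift ha g, symMul φ (backShift ha f) (memLp_backShift ha hf)⟫_ℂ := by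
  set f₁ := modelShift ha hu hua f
  set g₁ := modelShift ha hu hua g
  have hf₁ : MemLp (backShift ha f) ∞ σ := memLp_backShift ha hf
  have hb : MemLp (mulC (blaschkeC ha) (backShift ha f)) ∞ σ := memLp_mulC _ hf₁
  have e1 : ⟪g, A f⟫_ℂ = kernelCoeff ha (f : L2) * ⟪g, A (kernelModel ha hu hua)⟫_ℂ +
      (conj (kernelCoeff ha (g : L2)) *
        ⟪kernelModel ha hu hua, A (blaschkeMul ha hu hua f₁)⟫_ℂ +
        ⟪blaschkeMul ha hu hua g₁, A (blaschkeMul ha hu hua f₁)⟫_ℂ) :=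
    inner_map_smul_add A (kernelModel_smul_add ha hu hua f) (kernelModel_smul_add ha hu hua g)
  have e2 : ⟪(g : L2), symMul φ f hf⟫_ℂ =
      kernelCoeff ha (f : L2) * ⟪(g : L2), symMul φ (kernelL2 ha) (memLp_kernelL2 ha)⟫_ℂ +
      (conj (kernelCoeff ha (g : L2)) *
        ⟪kernelL2 ha, symMul φ (mulC (blaschkeC ha) (backShift ha f)) hb⟫_ℂ +
        ⟪mulC (blaschkeC ha) (backShift ha g),
          symMul φ (mulC (blaschkeC ha) (backShift ha f)) hb⟫_ℂ) := by
    rw [symMul_smul_add φ hf (memLp_kernelL2 ha) hb (kernelCoeff_smul_add ha (f : L2)).symm,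
      inner_add_right, inner_smul_right]
    congr 1
    conv_lhs => rw [← kernelCoeff_smul_add ha (g : L2)]
    rw [inner_add_left, inner_smul_left]
  have e3 : ⟪mulC (blaschkeC ha) (backShift ha g),
      symMul φ (mulC (blaschkeC ha) (backShift ha f)) hb⟫_ℂ =
      ⟪backShift ha g, symMul φ (backShift ha f) hf₁⟫_ℂ := by
    rw [← mulC_symMul _ _ _ hf₁, inner_mulC_left, mulC_mulC, star_blaschkeC_mul, mulC_one]
  have e4 : ⟪kernelModel ha hu hua, A (blaschkeMul ha hu hua f₁)⟫_ℂ =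
      ⟪kernelL2 ha, symMul φ (mulC (blaschkeC ha) (backShift ha f)) hb⟫_ℂ :=
    hleft (blaschkeMul ha hu hua f₁) hb
  rw [e1, e2, e3, hright, e4, hinv]
  ring

lemma modelIncl_modelShift_coe (hu : IsInner u) (hua : u a = 0) (f : modelSpace u) (n : ℕ) :
    (((fun x => modelIncl ha hu hua (modelShift ha hu hua x))^[n] f : modelSpace u) : L2) =
      (backShift ha)^[n] (f : L2) := by
  induction n with
  | zero => rfl
  | succ n ih =>
    rw [Function.iterate_succ_apply', Function.iterate_succ_apply', ← ih]
    rfl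

lemma tendsto_iterate_modelShift (hu : IsInner u) (hua : u a = 0) (f : modelSpace u) :
    Tendsto (fun n => (fun x => modelIncl ha hu hua (modelShift ha hu hua x))^[n] f) atTop
      (𝓝 0) := by
  rw [tendsto_subtype_rng]
  simp only [modelIncl_modelShift_coe]
  exact tendsto_iterate_backShift ha ((mem_modelSpace_iff hu).1 f.2).1

/-- A bounded operator whose sesquilinear form is invariant under multiplication by `b_a` is a
truncated Toeplitz operator. -/
theorem isTruncatedToeplitz_of_invariant (hu : IsInner u) (hua : u a = 0)
    {A : modelSpace u →L[ℂ] modelSpace u}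
    (hinv : ∀ f g : modelSpace (divBlaschke u a),
      ⟪blaschkeMul ha hu hua g, A (blaschkeMul ha hu hua f)⟫_ℂ =
        ⟪modelIncl ha hu hua g, A (modelIncl ha hu hua f)⟫_ℂ) :
    IsTruncatedToeplitz u A := by
  set k := kernelModel ha hu hua
  set p : modelSpace u := A k with hp
  set q : modelSpace u := ContinuousLinearMap.adjoint A k with hq
  have hH2 : ∀ x : modelSpace u, (x : L2) ∈ H2 := fun x => ((mem_modelSpace_iff hu).1 x.2).1
  have hpq : ⟪kernelL2 ha, (p : L2)⟫_ℂ = conj ⟪kernelL2 ha, (q : L2)⟫_ℂ := by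
    change ⟪k, A k⟫_ℂ = conj ⟪k, ContinuousLinearMap.adjoint A k⟫_ℂ
    rw [ContinuousLinearMap.adjoint_inner_right, inner_conj_symm]
  set φ := kernelSymbol ha (p : L2) (q : L2) with hφ
  have hright : ∀ g : modelSpace u, ⟪g, A k⟫_ℂ =
      ⟪(g : L2), symMul φ (kernelL2 ha) (memLp_kernelL2 ha)⟫_ℂ := fun g =>
    (inner_symMul_kernelSymbol_kernelL2 ha (hH2 q) (hH2 g)).symm
  have hleft : ∀ (f : modelSpace u) (hf : MemLp ((f : L2) : T → ℂ) ∞ σ),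
      ⟪k, A f⟫_ℂ = ⟪kernelL2 ha, symMul φ f hf⟫_ℂ := fun f hf => by
    rw [hφ, inner_kernelL2_symMul_kernelSymbol ha (hH2 p) (hH2 q) hpq (hH2 f) hf,
      ← ContinuousLinearMap.adjoint_inner_left]
    rfl
  refine (isTruncatedToeplitz_iff A).2 ⟨φ, fun f hf g => ?_⟩
  refine (dense_bounded hu).induction (P := fun g => ⟪g, A f⟫_ℂ = ⟪(g : L2), symMul φ f hf⟫_ℂ)
    (fun g hg => ?_) ?_ g
  · -- The difference of the two forms is unchanged by the backward shift and tends to zero.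
    set S : modelSpace u → modelSpace u :=
      fun x => modelIncl ha hu hua (modelShift ha hu hua x) with hS
    have hconst : ∀ n, ⟪S^[n] g, A (S^[n] f)⟫_ℂ -
        ⟪(backShift ha)^[n] (g : L2), symMul φ ((backShift ha)^[n] (f : L2))
          (memLp_iterate_backShift ha hf n)⟫_ℂ =
        ⟪g, A f⟫_ℂ - ⟪(g : L2), symMul φ f hf⟫_ℂ := by
      intro n
      induction n generalizing f g with
      | zero => rfl
      | succ n ih =>
        rw [sub_symMul_modelShift ha hu hua hinv hright hleft f g hf]
        exact ih (S f) (memLp_backShift ha hf) (S g) (memLp_backShift ha hg)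
    have h1 : Tendsto (fun n => ⟪S^[n] g, A (S^[n] f)⟫_ℂ) atTop (𝓝 0) := by
      have := (tendsto_iterate_modelShift ha hu hua g).inner (𝕜 := ℂ)
        ((A.continuous.tendsto 0).comp (tendsto_iterate_modelShift ha hu hua f))
      rwa [inner_zero_left] at this
    have h2 := h1.sub (tendsto_inner_symMul_kernelSymbol ha (hH2 p) (hH2 q) (hH2 f) (hH2 g) hf hg)
    rw [sub_zero] at h2
    exact sub_eq_zero.1 (tendsto_nhds_unique (tendsto_const_nhds.congr fun n => (hconst n).symm) h2)
  · exact isClosed_eq (Continuous.inner (𝕜 := ℂ) (E := modelSpace u) continuous_id'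
      continuous_const) (continuous_subtype_val.inner continuous_const)

end

end TTO
end

theorem mainTheorem1 (u : ℂ → ℂ) (hu : TTO.IsInner u) (a : ℂ) (ha : a ∈ TTO.disc) (hua : u a = 0)
    (A : TTO.modelSpace u →L[ℂ] TTO.modelSpace u) :
    TTO.IsTruncatedToeplitz u A ↔
      TTO.IsCSymmetric (TTO.modelConj hu) A ∧
      ∀ f : TTO.modelSpace (TTO.divBlaschke u a),
        TTO.quadForm A (Submodule.inclusion (TTO.modelSpace_divBlaschke_le hu ha hua)
            (TTO.modelConj (TTO.isInner_divBlaschke hu ha hua) f)) =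
          TTO.quadForm A (Submodule.inclusion (TTO.modelSpace_divBlaschke_le hu ha hua) f) := by
  constructor
  · intro hA
    exact ⟨hA.isCSymmetric hu, hA.quadForm_modelConj (TTO.isInner_divBlaschke hu ha hua)
      (TTO.modelSpace_divBlaschke_le hu ha hua)⟩
  · rintro ⟨hC, hQ⟩
    exact TTO.isTruncatedToeplitz_of_invariant ha hu hua (TTO.inner_blaschkeMul hu ha hua hC hQ)
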